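/- Let \(p\) be a prime. A \(\delta\)-ring is a commutative ring \(A\) with a map \(\delta\colon A\to A\) such that \(\delta(0)=\delta(1)=0\), \(\delta(a+b)=\delta(a)+\delta(b)+\frac{a^p+b^p-(a+b)^p}{p}\) and \(\delta(ab)=a^p\delta(b)+b^p\delta(a)+p\,\delta(a)\delta(b)\); its Frobenius lift is the ring endomorphism \(\varphi_A(a)=a^p+p\,\delta(a)\). A prism \((A,I)\) is a \(\delta\)-ring \(A\) with an ideal \(I\) such that \(I\) is a locally free \(A\)-module of rank \(1\), \(A\) is derived \((p,I)\)-complete, and \(p\in I+\varphi_A(I)A\). The prism is crystalline if \(I=(p)\), and transversal if \(I=(\xi)\) for some \(\xi\) such that \(p,\xi\) is a regular sequence on \(A\). A regular local prism is a transversal or crystalline prism \((A,I)\) such that \(A\) is a regular local ring. For an ideal \(\mathfrak a\subseteq A\), a ring map \(A\to B\) is \(\mathfrak a\)-completely faithfully flat if \(\mathrm{Tor}_i^A(B,A/\mathfrak a)=0\) for all \(i\ge 1\) and \(B/\mathfrak aB\) is faithfully flat over \(A/\mathfrak a\). Let \(I^{[p]}\) be the ideal generated by all \(f^p\) with \(f\in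 I\). Proposition. Let \((A,I)\) be a prism such that \(A\) is a Noetherian local ring. Then the following are equivalent: 1. \((A,I)\) is a regular local prism. 2. \(\varphi_A\colon A\to A\) is faithfully flat. 3. \(\varphi_A\) is \(p\)-completely faithfully flat. 4. \(\varphi_A\) is \(I\)-completely faithfully flat. 5. The Frobenius map \(A/pA\to A/pA\), \(x\mapsto x^p\), is faithfully flat. 6. \((A,I)\) is transversal or crystalline, and the map \(A/I\to A/\varphi_A(I)A\) induced by \(\varphi_A\) is faithfully flat. 7. \((A,I)\) is transversal or crystalline, and the \(p\)-th power map \(A/(p,I)\to A/(p,I^{[p]})\) induced by \(\varphi_A\) is faithfully flat. -/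

import Mathlib

noncomputable section

/-- A `δ`-structure (relative to the prime `p`) on a commutative ring `A`. The expression
`(a ^ p + b ^ p - (a + b) ^ p) / p` of the additivity rule is the integral polynomial
`- ∑_{0 < k < p} (p.choose k / p) a ^ k b ^ (p - k)`; the division is exact. -/
structure DeltaStructure (p : ℕ) (A : Type*) [CommRing A] where
  δ : A → A
  δ_zero : δ 0 = 0
  δ_one : δ 1 = 0
  δ_add : ∀ a b : A, δ (a + b) =
    δ a + δ b - ∑ k ∈ Finset.Ioo 0 p, a ^ k * b ^ (p - k) * ((p.choose k / p : ℕ) : A)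
  δ_mul : ∀ a b : A, δ (a * b) = a ^ p * δ b + b ^ p * δ a + (p : A) * δ a * δ b

namespace DeltaStructure

variable {p : ℕ} [Fact p.Prime] {A : Type*} [CommRing A]

/-- The Frobenius lift `φ(a) = a ^ p + p δ(a)` of a `δ`-ring, as a ring endomorphism. -/
def φ (D : DeltaStructure p A) : A →+* A where
  toFun a := a ^ p + (p : A) * D.δ a
  map_one' := by rw [D.δ_one]; simp
  map_zero' := by rw [D.δ_zero]; simp [(Fact.out : p.Prime).ne_zero]
  map_mul' a b := by rw [D.δ_mul]; ring
  map_add' a b := by rw [D.δ_add, add_pow_prime_eq' Fact.out]; ring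

theorem φ_apply (D : DeltaStructure p A) (a : A) : D.φ a = a ^ p + (p : A) * D.δ a := rfl

end DeltaStructure

/-- An `A`-module `M` is derived `𝔞`-complete if for every `f ∈ 𝔞` the derived limit
`R lim (⋯ → M → M → M)` along multiplication by `f` (that is, `RHom_A(A_f, M)`) vanishes. This
derived limit is computed by the two-term complex `∏ M → ∏ M`, `(x_n) ↦ (x_n - f x_{n+1})`, whose
kernel and cokernel are `lim` and `lim¹`; so it vanishes iff this map is bijective. -/
def IsDerivedComplete {A : Type*} [CommRing A] (𝔞 : Ideal A)
    (M : Type*) [AddCommGroup M] [Module A M] : Prop :=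
  ∀ f ∈ 𝔞, Function.Bijective (fun (x : ℕ → M) (n : ℕ) => x n - f • x (n + 1))

section Prism

variable {p : ℕ} [Fact p.Prime] {A : Type*} [CommRing A]

/-- The `δ`-pair `(A, I)` is a prism. -/
structure IsPrism (D : DeltaStructure p A) (I : Ideal A) : Prop where
  invertible : Module.Invertible A I
  derivedComplete : IsDerivedComplete (Ideal.span {(p : A)} ⊔ I) A
  p_mem : (p : A) ∈ I ⊔ I.map D.φ

/-- A prism `(A, I)` is crystalline if `I = (p)`. -/
structure IsCrystallinePrism (D : DeltaStructure p A) (I : Ideal A) : Prop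
    extends IsPrism D I where
  eq_span : I = Ideal.span {(p : A)}

/-- A prism `(A, I)` is transversal if `I` has a generator `ξ` such that `p, ξ` is a regular
sequence on `A`. -/
structure IsTransversalPrism (D : DeltaStructure p A) (I : Ideal A) : Prop
    extends IsPrism D I where
  exists_regular : ∃ ξ : A, I = Ideal.span {ξ} ∧ RingTheory.Sequence.IsRegular A [(p : A), ξ]

/-- A regular local prism: a transversal or crystalline prism `(A, I)` such that `A` is a regular
local ring. -/
structure IsRegularLocalPrism (D : DeltaStructure p A) (I : Ideal A) : Prop where
  transversal_or_crystalline : IsTransversalPrism D I ∨ IsCrystallinePrism D I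
  isRegularLocalRing : IsRegularLocalRing A

end Prism

section CompletelyFlat

universe u

/-- An `A`-module `M` is `𝔞`-completely faithfully flat if `M ⊗ᴸ_A A/𝔞` is concentrated in degree
`0`, i.e. `Tor_i^A(M, A/𝔞) = 0` for all `i ≥ 1`, and `M/𝔞M` is a faithfully flat `A/𝔞`-module. -/
structure IsCompletelyFaithfullyFlat {A : Type u} [CommRing A] (𝔞 : Ideal A)
    (M : Type u) [AddCommGroup M] [Module A M] : Prop where
  isZero_tor : ∀ i : ℕ, CategoryTheory.Limits.IsZero
    (((CategoryTheory.Tor (ModuleCat.{u} A) (i + 1)).obj (ModuleCat.of A M)).obj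
      (ModuleCat.of A (A ⧸ 𝔞)))
  faithfullyFlat : Module.FaithfullyFlat (A ⧸ 𝔞) (M ⧸ (𝔞 • ⊤ : Submodule A M))

/-- A ring map `f : A → B` is `𝔞`-completely faithfully flat if `B` is so as an `A`-module
via `f`. -/
def RingHom.IsCompletelyFaithfullyFlat {A B : Type u} [CommRing A] [CommRing B]
    (f : A →+* B) (𝔞 : Ideal A) : Prop :=
  letI : Algebra A B := f.toAlgebra
  _root_.IsCompletelyFaithfullyFlat 𝔞 B

end CompletelyFlat

section InducedMaps

variable {p : ℕ} [Fact p.Prime] {A : Type*} [CommRing A]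

/-- The Frobenius map `x ↦ x ^ p` of `A/pA`. -/
def frobeniusModP (p : ℕ) [Fact p.Prime] (A : Type*) [CommRing A] :
    (A ⧸ Ideal.span {(p : A)}) →+* (A ⧸ Ideal.span {(p : A)}) where
  toFun x := x ^ p
  map_one' := one_pow p
  map_zero' := zero_pow (Fact.out : p.Prime).ne_zero
  map_mul' x y := mul_pow x y p
  map_add' x y := by
    have h : (p : A ⧸ Ideal.span {(p : A)}) = 0 := by
      have := Ideal.Quotient.eq_zero_iff_mem.mpr (Ideal.mem_span_singleton_self (p : A))
      simpa using this
    rw [add_pow_prime_eq Fact.out, h]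
    ring

/-- The `p`-th Frobenius power `I^[p]`: the ideal generated by the `f ^ p` with `f ∈ I`. -/
def Ideal.frobeniusPower (p : ℕ) (I : Ideal A) : Ideal A :=
  Ideal.span ((fun f : A => f ^ p) '' (I : Set A))

namespace DeltaStructure

/-- The map `A/I → A/φ(I)A` induced by `φ`. -/
def φModI (D : DeltaStructure p A) (I : Ideal A) : (A ⧸ I) →+* (A ⧸ I.map D.φ) :=
  Ideal.quotientMap (I.map D.φ) D.φ Ideal.le_comap_map

theorem sup_le_comap_φ (D : DeltaStructure p A) (I : Ideal A) :
    Ideal.span {(p : A)} ⊔ I ≤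
      (Ideal.span {(p : A)} ⊔ I.frobeniusPower p).comap D.φ := by
  have hp : (p : A) ∈ Ideal.span {(p : A)} ⊔ I.frobeniusPower p :=
    Ideal.mem_sup_left (Ideal.mem_span_singleton_self _)
  refine sup_le ?_ fun f hf => ?_
  · rw [Ideal.span_singleton_le_iff_mem, Ideal.mem_comap, map_natCast]
    exact hp
  · rw [Ideal.mem_comap, φ_apply]
    exact Ideal.add_mem _ (Ideal.mem_sup_right (Ideal.subset_span ⟨f, hf, rfl⟩))
      (Ideal.mul_mem_right _ _ hp)

/-- The map `A/(p, I) → A/(p, I^[p])` induced by `φ`; it is the `p`-th power map, as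
`φ(a) ≡ a ^ p` modulo `p`. -/
def φModPI (D : DeltaStructure p A) (I : Ideal A) :
    (A ⧸ (Ideal.span {(p : A)} ⊔ I)) →+*
      (A ⧸ (Ideal.span {(p : A)} ⊔ I.frobeniusPower p)) :=
  Ideal.quotientMap _ D.φ (D.sup_le_comap_φ I)

end DeltaStructure

end InducedMaps

end

/-! The hub of the equivalences is 1 → 2 → 5 → 1. Write `m` for the maximal ideal; derived
completeness puts `p` and `I` inside it. 1 → 2: `δ(p)` is a unit, being `1` modulo `p`, whereas `δ`
maps `m²` into `m`; so `p ∉ m²` (`p_notMem_sq`) and `A/p` is again regular. Frobenius on a regular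
local ring sends a regular system of parameters to a regular sequence, hence is flat
(`IsRegularLocalRing.flat_pow`). The local criterion along `p`
(`Module.Flat.of_flat_quotient_span_singleton`) lifts flatness to `φ`, which is a local map, so flat
means faithfully flat. 2 → 5 is base change along `A → A/p`. 5 → 1: the converse half of Kunz's
theorem (`IsRegularLocalRing.of_flat_pow`), proved by comparing lengths with Lech's lemma, makes
`A/p` regular, hence a domain. The `δ`-structure then forces `p` to be a nonzerodivisor
(`isSMulRegular_p`), so `p` followed by lifted parameters is a regular system of parameters of `A`.
A generator `d` of `I` has `δ(d)` a unit: if `p ∣ d` this gives `I = (p)`, and otherwise `p, d` is a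
regular sequence because `A/p` is a domain. Conditions 3, 4, 6 and 7 follow from 2 by base change.
Condition 3 returns to 5 on reduction mod `p`. Conditions 4, 6 and 7 return to 2 by the local
criterion, once the image of the generator is a nonzerodivisor: by vanishing of `Tor₁` in case 4,
and by `φ(ξ) ≡ ξ^p` mod `p` or invertibility of `I = (p)` in the other cases. -/

/-! ### Local criterion of flatness along one element. -/

section LocalCriterion

open TensorProduct

variable {R S : Type*} [CommRing R] [CommRing S] [Algebra R S] {x : R}

/-- If `S / xS` is flat over `R / x`, then `S ⊗ -` preserves injections between modules killed
by `x`. -/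
theorem lTensor_injective_of_flat_quotient
    [Module.Flat (R ⧸ Ideal.span {x}) ((R ⧸ Ideal.span {x}) ⊗[R] S)]
    {N N' : Type*} [AddCommGroup N] [Module R N] [AddCommGroup N'] [Module R N']
    (hN : ∀ n : N, x • n = 0) (hN' : ∀ n : N', x • n = 0)
    (g : N →ₗ[R] N') (hg : Function.Injective g) : Function.Injective (g.lTensor S) := by
  have h1 : Module.IsTorsionBySet R N (Ideal.span {x} : Ideal R) :=
    (Module.isTorsionBySet_span_singleton_iff x).mpr hN
  have h2 : Module.IsTorsionBySet R N' (Ideal.span {x} : Ideal R) :=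
    (Module.isTorsionBySet_span_singleton_iff x).mpr hN'
  let := h1.module
  let := h2.module
  have := h1.isScalarTower (S := R)
  have := h2.isScalarTower (S := R)
  let g' : N →ₗ[R ⧸ Ideal.span {x}] N' :=
    { g with
      map_smul' := fun r n => by
        obtain ⟨r, rfl⟩ := Ideal.Quotient.mk_surjective r
        exact g.map_smul r n }
  have hg' : Function.Injective (g'.rTensor ((R ⧸ Ideal.span {x}) ⊗[R] S)) :=
    Module.Flat.rTensor_preserves_injective_linearMap g' hg
  let e := AlgebraTensorModule.cancelBaseChange R (R ⧸ Ideal.span {x}) (R ⧸ Ideal.span {x}) N S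
  let e' := AlgebraTensorModule.cancelBaseChange R (R ⧸ Ideal.span {x}) (R ⧸ Ideal.span {x}) N' S
  have hc : ∀ z, g.rTensor S (e z) = e' (g'.rTensor _ z) := by
    intro z
    induction z with
    | zero => simp
    | add a b ha hb => simp only [map_add, ha, hb]
    | tmul n t =>
      induction t with
      | zero => simp
      | add a b ha hb => simp only [tmul_add, map_add, ha, hb]
      | tmul r s =>
        have : g (r • n) = r • g n := g'.map_smul r n
        simp [e, e', g', this]
  have : Function.Injective (g.rTensor S) := by
    intro a b hab
    obtain ⟨a, rfl⟩ := e.surjective a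
    obtain ⟨b, rfl⟩ := e.surjective b
    rw [hc, hc] at hab
    rw [hg' (e'.injective hab)]
  exact (LinearMap.lTensor_inj_iff_rTensor_inj S g).mpr this

variable (S) in
/-- If `S / xS` is flat over `R / x` and `x` is a nonzerodivisor on `S`, then `S ⊗ -` preserves
the injection of a submodule `K` of a free module `F` with `xF ⊆ K`. -/
theorem lTensor_subtype_injective_of_smul_mem
    [Module.Flat (R ⧸ Ideal.span {x}) ((R ⧸ Ideal.span {x}) ⊗[R] S)]
    (hx : IsSMulRegular S x) {F : Type*} [AddCommGroup F] [Module R F] [Module.Flat R F]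
    (K : Submodule R F) (hK : ∀ f : F, x • f ∈ K) :
    Function.Injective (K.subtype.lTensor S) := by
  rw [injective_iff_map_eq_zero]
  intro z hz
  let m : F →ₗ[R] K := (LinearMap.lsmul R F x).codRestrict K hK
  let q := LinearMap.range (LinearMap.lsmul R F x)
  let g : (K ⧸ LinearMap.range m) →ₗ[R] (F ⧸ q) :=
    Submodule.mapQ _ _ K.subtype (by rintro _ ⟨f, rfl⟩; exact ⟨f, rfl⟩)
  -- `K/xF → F/xF` is an injection of modules killed by `x`, so the flatness of `S/xS` applies to
  -- it; regularity of `x` on `S ⊗ F` disposes of the part coming from `xF`.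
  have hg : Function.Injective g := by
    rw [injective_iff_map_eq_zero]
    intro y hy
    obtain ⟨y, rfl⟩ := Submodule.mkQ_surjective _ y
    obtain ⟨f, hf⟩ := (Submodule.Quotient.mk_eq_zero _).mp hy
    exact (Submodule.Quotient.mk_eq_zero _).mpr ⟨f, Subtype.ext hf⟩
  have hg' := lTensor_injective_of_flat_quotient (S := S) (x := x) ?_ ?_ g hg
  · have hz' : (LinearMap.range m).mkQ.lTensor S z = 0 := by
      apply hg'
      rw [map_zero, ← LinearMap.lTensor_comp_apply]
      have : g ∘ₗ (LinearMap.range m).mkQ = q.mkQ ∘ₗ K.subtype := rfl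
      rw [this, LinearMap.lTensor_comp_apply, hz, map_zero]
    obtain ⟨w, rfl⟩ := (lTensor_exact S (LinearMap.exact_map_mkQ_range m)
      (Submodule.mkQ_surjective _) z).mp hz'
    rw [← LinearMap.lTensor_comp_apply] at hz
    have hm : K.subtype ∘ₗ m = LinearMap.lsmul R F x := rfl
    have hr : IsSMulRegular (S ⊗[R] F) x := hx.rTensor F
    have hs : ∀ w : S ⊗[R] F, (LinearMap.lsmul R F x).lTensor S w = x • w := by
      intro w
      induction w with
      | zero => simp
      | add a b ha hb => simp only [smul_add, map_add, ha, hb]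
      | tmul s f => simp
    have : x • w = 0 := by
      rw [← hs, ← hm, hz]
    rw [hr.right_eq_zero_of_smul this, map_zero]
  · intro n
    obtain ⟨n, rfl⟩ := Submodule.mkQ_surjective _ n
    exact (Submodule.Quotient.mk_eq_zero _).mpr ⟨n.1, rfl⟩
  · intro n
    obtain ⟨n, rfl⟩ := Submodule.mkQ_surjective _ n
    exact (Submodule.Quotient.mk_eq_zero _).mpr ⟨n, rfl⟩

-- Pull `a ≤ b` back along a flat cover `F → b`: the preimage `K` of `a` contains `xF`, so `S ⊗ K →
-- S ⊗ F` is injective. An element dying in `S ⊗ b` then comes from `S ⊗ ker π`, which maps to zero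
-- in `S ⊗ a`.
variable (S) in
theorem lTensor_inclusion_injective_of_surjective
    [Module.Flat (R ⧸ Ideal.span {x}) ((R ⧸ Ideal.span {x}) ⊗[R] S)]
    (hx : IsSMulRegular S x) {a b : Ideal R} (hab : a ≤ b) (h : ∀ r ∈ b, x * r ∈ a)
    {F : Type*} [AddCommGroup F] [Module R F] [Module.Flat R F] (π : F →ₗ[R] b)
    (hπ : Function.Surjective π) :
    Function.Injective ((Submodule.inclusion hab).lTensor S) := by
  rw [injective_iff_map_eq_zero]
  intro z hz
  let K : Submodule R F := (Submodule.comap b.subtype a).comap π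
  have hK : ∀ f, x • f ∈ K := fun f => by
    change ((π (x • f) : b) : R) ∈ a
    rw [map_smul]
    exact h _ (π f).2
  have hinj := lTensor_subtype_injective_of_smul_mem S hx K hK
  let πK : K →ₗ[R] a := (b.subtype ∘ₗ π ∘ₗ K.subtype).codRestrict a fun k => k.2
  have hπK : Function.Surjective πK := fun y => by
    obtain ⟨f, hf⟩ := hπ ⟨y, hab y.2⟩
    refine ⟨⟨f, ?_⟩, Subtype.ext ?_⟩
    · change ((π f : b) : R) ∈ a
      rw [hf]; exact y.2
    · exact congrArg (fun y : b => (y : R)) hf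
  have hCK : LinearMap.ker π ≤ K := fun f hf => by
    change ((π f : b) : R) ∈ a
    rw [LinearMap.mem_ker.mp hf]; exact a.zero_mem
  obtain ⟨w, rfl⟩ := LinearMap.lTensor_surjective S hπK z
  have hw : π.lTensor S (K.subtype.lTensor S w) = 0 := by
    rw [← hz, ← LinearMap.lTensor_comp_apply, ← LinearMap.lTensor_comp_apply]
    rfl
  have hex : Function.Exact (LinearMap.ker π).subtype π := LinearMap.exact_subtype_ker_map π
  obtain ⟨c, hc⟩ := (lTensor_exact S hex hπ _).mp hw
  have hcw : (Submodule.inclusion hCK).lTensor S c = w := by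
    apply hinj
    rw [← hc, ← LinearMap.lTensor_comp_apply]
    rfl
  rw [← hcw, ← LinearMap.lTensor_comp_apply]
  have : πK ∘ₗ Submodule.inclusion hCK = 0 := by
    ext f
    exact congrArg (fun y : b => (y : R)) (LinearMap.mem_ker.mp f.2)
  rw [this, LinearMap.lTensor_zero, LinearMap.zero_apply]

variable (S) in
theorem lTensor_inclusion_injective_of_smul_mem
    [Module.Flat (R ⧸ Ideal.span {x}) ((R ⧸ Ideal.span {x}) ⊗[R] S)]
    (hx : IsSMulRegular S x) {a b : Ideal R} (hab : a ≤ b) (h : ∀ r ∈ b, x * r ∈ a) :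
    Function.Injective ((Submodule.inclusion hab).lTensor S) :=
  lTensor_inclusion_injective_of_surjective S hx hab h (F := b →₀ R)
    (Finsupp.linearCombination R id) (Finsupp.linearCombination_id_surjective R b)

-- The hypothesis says `a ∩ xR = xa`, so `a/xa → R/xR` is injective and remains so after tensoring
-- with `S`. Thus an element of the kernel `T` of `S ⊗ a → S ⊗ R` has the form `xw`, and `w ∈ T`
-- since `x` is regular. Hence `T = xT`, and Nakayama over `S` gives `T = 0`.
variable (S) in
theorem lTensor_subtype_injective_of_mem_of_mul_mem [IsNoetherianRing R] [IsNoetherianRing S]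
    [Module.Flat (R ⧸ Ideal.span {x}) ((R ⧸ Ideal.span {x}) ⊗[R] S)]
    (hx : IsSMulRegular S x) (hJ : algebraMap R S x ∈ Ideal.jacobson (⊥ : Ideal S))
    {a : Ideal R} (h : ∀ r, x * r ∈ a → r ∈ a) :
    Function.Injective (a.subtype.lTensor S) := by
  let T : Submodule S (S ⊗[R] a) := LinearMap.ker (a.subtype.baseChange S)
  have hT : ∀ z, z ∈ T ↔ a.subtype.lTensor S z = 0 := fun z => Iff.rfl
  suffices T = ⊥ by
    rw [injective_iff_map_eq_zero]
    intro z hz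
    have : z ∈ T := hz
    simpa [‹T = ⊥›] using this
  refine Submodule.eq_bot_of_le_smul_of_le_jacobson_bot (Ideal.span {algebraMap R S x}) T
    (IsNoetherian.noetherian T) ?_ ((Ideal.span_singleton_le_iff_mem _).mpr hJ)
  intro z hz
  rw [hT] at hz
  let g : (a ⧸ LinearMap.range (LinearMap.lsmul R a x)) →ₗ[R]
      (R ⧸ LinearMap.range (LinearMap.lsmul R R x)) :=
    Submodule.mapQ _ _ a.subtype (by rintro _ ⟨f, rfl⟩; exact ⟨f, rfl⟩)
  have hg : Function.Injective g := by
    rw [injective_iff_map_eq_zero]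
    intro y hy
    obtain ⟨y, rfl⟩ := Submodule.mkQ_surjective _ y
    obtain ⟨f, hf⟩ := (Submodule.Quotient.mk_eq_zero _).mp hy
    have hf' : x * f = y := hf
    exact (Submodule.Quotient.mk_eq_zero _).mpr ⟨⟨f, h f (hf' ▸ y.2)⟩, Subtype.ext hf'⟩
  have hg' := lTensor_injective_of_flat_quotient (S := S) (x := x) ?_ ?_ g hg
  · have hz' : (LinearMap.range (LinearMap.lsmul R a x)).mkQ.lTensor S z = 0 := by
      apply hg'
      rw [map_zero, ← LinearMap.lTensor_comp_apply]
      have : g ∘ₗ (LinearMap.range (LinearMap.lsmul R a x)).mkQ =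
        (LinearMap.range (LinearMap.lsmul R R x)).mkQ ∘ₗ a.subtype := rfl
      rw [this, LinearMap.lTensor_comp_apply, hz, map_zero]
    obtain ⟨w, rfl⟩ := (lTensor_exact S (LinearMap.exact_map_mkQ_range _)
      (Submodule.mkQ_surjective _) z).mp hz'
    have hs : ∀ w : S ⊗[R] a,
        (LinearMap.lsmul R a x).lTensor S w = algebraMap R S x • w := by
      intro w
      induction w with
      | zero => simp
      | add a b ha hb => rw [map_add, smul_add, ha, hb]
      | tmul s f => simp [smul_tmul']
    rw [hs]
    refine Submodule.smul_mem_smul (Ideal.mem_span_singleton_self _) ?_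
    rw [hT]
    rw [hs] at hz
    have hz2 : a.subtype.baseChange S (algebraMap R S x • w) = 0 := hz
    rw [map_smul, algebraMap_smul] at hz2
    exact (hx.rTensor R).right_eq_zero_of_smul hz2
  · intro n
    obtain ⟨n, rfl⟩ := Submodule.mkQ_surjective _ n
    exact (Submodule.Quotient.mk_eq_zero _).mpr ⟨n, rfl⟩
  · intro n
    obtain ⟨n, rfl⟩ := Submodule.mkQ_surjective _ n
    exact (Submodule.Quotient.mk_eq_zero _).mpr ⟨n, rfl⟩

/-- Local criterion of flatness for a principal ideal: if `x` is a nonzerodivisor on `S` lying in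
the Jacobson radical of `S` and `S / xS` is flat over `R / x`, then `S` is flat over `R`. -/
theorem Module.Flat.of_flat_quotient_span_singleton [IsNoetherianRing R] [IsNoetherianRing S]
    [Module.Flat (R ⧸ Ideal.span {x}) ((R ⧸ Ideal.span {x}) ⊗[R] S)]
    (hx : IsSMulRegular S x) (hJ : algebraMap R S x ∈ Ideal.jacobson (⊥ : Ideal S)) :
    Module.Flat R S := by
  rw [Module.Flat.iff_lTensor_injective']
  intro a
  induction a using WellFoundedGT.induction with
  | ind a ih =>
    by_cases h : ∀ r, x * r ∈ a → r ∈ a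
    · exact lTensor_subtype_injective_of_mem_of_mul_mem S hx hJ h
    -- `b` is the colon ideal `(a : x)`, strictly larger than `a` here; Noetherian induction handles
    -- `b`, and `xb ⊆ a` handles the inclusion of `a` in `b`.
    · let b : Ideal R := Submodule.comap (LinearMap.lsmul R R x) a
      have hab : a ≤ b := fun r hr => a.mul_mem_left x hr
      have hlt : a < b := lt_of_le_of_ne hab fun hb => h fun r hr => by
        rw [hb]; exact hr
      have h1 := lTensor_inclusion_injective_of_smul_mem S hx hab fun r hr => hr
      have h2 : a.subtype = b.subtype ∘ₗ Submodule.inclusion hab := rfl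
      rw [h2, LinearMap.lTensor_comp]
      exact (ih b hlt).comp h1

end LocalCriterion

/-! ### Induced maps on quotients as base changes. -/

section QuotientMap

open TensorProduct

variable {R S : Type*} [CommRing R] [CommRing S]

/-- The map induced by `f` modulo `I` is the base change of `f` along `R → R / I`. -/
theorem RingHom.flat_quotientMap_iff [Algebra R S] (I : Ideal R) :
    (Ideal.quotientMap (I.map (algebraMap R S)) (algebraMap R S) Ideal.le_comap_map).Flat ↔
      Module.Flat (R ⧸ I) ((R ⧸ I) ⊗[R] S) := by
  change (algebraMap (R ⧸ I) (S ⧸ I.map (algebraMap R S))).Flat ↔ _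
  rw [RingHom.flat_algebraMap_iff]
  exact Module.Flat.equiv_iff
    (Algebra.TensorProduct.quotIdealMapEquivQuotTensor S I).toLinearEquiv

theorem RingHom.faithfullyFlat_quotientMap_iff [Algebra R S] (I : Ideal R) :
    (Ideal.quotientMap (I.map (algebraMap R S)) (algebraMap R S) Ideal.le_comap_map).FaithfullyFlat
      ↔ Module.FaithfullyFlat (R ⧸ I) ((R ⧸ I) ⊗[R] S) := by
  change (algebraMap (R ⧸ I) (S ⧸ I.map (algebraMap R S))).FaithfullyFlat ↔ _
  rw [RingHom.faithfullyFlat_algebraMap_iff]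
  have e := (Algebra.TensorProduct.quotIdealMapEquivQuotTensor S I).toLinearEquiv
  exact ⟨fun _ => .of_linearEquiv _ _ e.symm, fun _ => .of_linearEquiv _ _ e⟩

theorem RingHom.FaithfullyFlat.quotientMap {f : R →+* S} (hf : f.FaithfullyFlat) {I : Ideal R}
    {J : Ideal S} (hIJ : J = I.map f) (h : I ≤ J.comap f) :
    (Ideal.quotientMap J f h).FaithfullyFlat := by
  subst hIJ
  algebraize [f]
  exact (RingHom.faithfullyFlat_quotientMap_iff I).mpr inferInstance

/-- Local criterion of flatness along a principal ideal, for ring homomorphisms. -/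
theorem RingHom.Flat.of_quotientMap [IsNoetherianRing R]
    [IsNoetherianRing S] (f : R →+* S) (x : R) (hx : IsSMulRegular S (f x))
    (hJ : f x ∈ Ideal.jacobson (⊥ : Ideal S)) {I : Ideal R} {J : Ideal S} (hI : I = Ideal.span {x})
    (hIJ : J = I.map f) (h : I ≤ J.comap f) (hf : (Ideal.quotientMap J f h).Flat) :
    f.Flat := by
  subst hI hIJ
  algebraize [f]
  have := (RingHom.flat_quotientMap_iff (Ideal.span {x})).mp hf
  have hx' : IsSMulRegular S x := fun a b hab => hx (by
    simpa only [Algebra.smul_def] using! hab)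
  exact Module.Flat.of_flat_quotient_span_singleton hx' hJ

end QuotientMap

/-! ### Lengths of quotients by ideals. -/

section Length

variable {R : Type*} [CommRing R]

theorem Ideal.length_quotient_anti {I J : Ideal R} (h : I ≤ J) :
    Module.length R (R ⧸ J) ≤ Module.length R (R ⧸ I) := by
  rw [Module.length_quotient, Module.length_quotient]
  exact Order.coheight_anti h

theorem Ideal.range_mapQ_toSpanSingleton {J J₁ J₂ : Ideal R} (g : R) (h₁ : J ≤ J₁) (hg : g ∈ J₁)
    (h₁' : J₁ ≤ J ⊔ Ideal.span {g}) (h₂ : ∀ r ∈ J₂, r * g ∈ J) :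
    LinearMap.range (Submodule.mapQ J₂ J (LinearMap.toSpanSingleton R R g) h₂) =
      LinearMap.ker (Submodule.factor h₁) := by
  ext y
  obtain ⟨y, rfl⟩ := Submodule.mkQ_surjective _ y
  constructor
  · rintro ⟨r, hr⟩
    obtain ⟨r, rfl⟩ := Submodule.mkQ_surjective _ r
    rw [← hr]
    exact (Submodule.Quotient.mk_eq_zero _).mpr (Ideal.mul_mem_left _ r hg)
  · intro hy
    have hy' : y ∈ J₁ := (Submodule.Quotient.mk_eq_zero _).mp hy
    obtain ⟨j, hj, z, hz, rfl⟩ := Submodule.mem_sup.mp (h₁' hy')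
    obtain ⟨r, rfl⟩ := Ideal.mem_span_singleton'.mp hz
    refine ⟨Submodule.mkQ _ r, (Submodule.Quotient.eq _).mpr ?_⟩
    simpa using hj

/-- Multiplication by `g` gives an exact sequence `R/J₂ → R/J → R/J₁ → 0`. Its first map is
injective when `J₂` is the full colon ideal `(J : g)`, which turns the bound into the equality of
the next lemma. -/
theorem Ideal.length_quotient_le_add {J J₁ J₂ : Ideal R} (g : R) (h₁ : J ≤ J₁) (hg : g ∈ J₁)
    (h₁' : J₁ ≤ J ⊔ Ideal.span {g}) (h₂ : ∀ r ∈ J₂, r * g ∈ J) :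
    Module.length R (R ⧸ J) ≤ Module.length R (R ⧸ J₁) + Module.length R (R ⧸ J₂) := by
  let m : (R ⧸ J₂) →ₗ[R] (R ⧸ J) :=
    Submodule.mapQ J₂ J (LinearMap.toSpanSingleton R R g) fun r hr => h₂ r hr
  have hq : Function.Surjective (Submodule.factor h₁) := Submodule.factor_surjective h₁
  rw [Module.length_eq_add_of_exact (LinearMap.range m).subtype (Submodule.factor h₁)
    Subtype.val_injective hq
    (LinearMap.exact_iff.mpr (by
      rw [Submodule.range_subtype]; exact (Ideal.range_mapQ_toSpanSingleton g h₁ hg h₁' h₂).symm)),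
    add_comm]
  gcongr
  exact Module.length_le_of_surjective m.rangeRestrict m.surjective_rangeRestrict

theorem Ideal.length_quotient_eq_add {J J₁ J₂ : Ideal R} (g : R) (h₁ : J ≤ J₁) (hg : g ∈ J₁)
    (h₁' : J₁ ≤ J ⊔ Ideal.span {g}) (h₂ : ∀ r, r * g ∈ J ↔ r ∈ J₂) :
    Module.length R (R ⧸ J) = Module.length R (R ⧸ J₁) + Module.length R (R ⧸ J₂) := by
  let m : (R ⧸ J₂) →ₗ[R] (R ⧸ J) :=
    Submodule.mapQ J₂ J (LinearMap.toSpanSingleton R R g) fun r hr => (h₂ r).mpr hr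
  have hm : Function.Injective m := by
    rw [injective_iff_map_eq_zero]
    intro y hy
    obtain ⟨r, rfl⟩ := Submodule.mkQ_surjective _ y
    exact (Submodule.Quotient.mk_eq_zero _).mpr
      ((h₂ r).mp ((Submodule.Quotient.mk_eq_zero _).mp hy))
  rw [Module.length_eq_add_of_exact m (Submodule.factor h₁) hm (Submodule.factor_surjective h₁)
    (LinearMap.exact_iff.mpr
      (Ideal.range_mapQ_toSpanSingleton g h₁ hg h₁' fun r hr => (h₂ r).mpr hr).symm), add_comm]

end Length

/-! ### Lech independence and length estimates for powers. -/

section Lech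

variable {R ι : Type*} [CommRing R]

theorem span_range_update_le_sup [DecidableEq ι] (v : ι → R) (i : ι) (g : R) :
    Ideal.span (Set.range (Function.update v i g)) ≤
      Ideal.span (Set.range v) ⊔ Ideal.span {g} := by
  rw [Ideal.span_le]
  rintro _ ⟨j, rfl⟩
  rcases eq_or_ne j i with rfl | hj
  · rw [Function.update_self]
    exact Ideal.mem_sup_right (Ideal.mem_span_singleton_self g)
  · rw [Function.update_of_ne hj]
    exact Ideal.mem_sup_left (Ideal.subset_span ⟨j, rfl⟩)

theorem mem_span_range_update_self [DecidableEq ι] (v : ι → R) (i : ι) (g : R) :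
    g ∈ Ideal.span (Set.range (Function.update v i g)) :=
  Ideal.subset_span ⟨i, Function.update_self ..⟩

theorem span_range_le_span_range_update [DecidableEq ι] {v : ι → R} {i : ι} {g : R}
    (hg : g ∣ v i) :
    Ideal.span (Set.range v) ≤ Ideal.span (Set.range (Function.update v i g)) := by
  rw [Ideal.span_le]
  rintro _ ⟨j, rfl⟩
  rcases eq_or_ne j i with rfl | hj
  · exact Ideal.mem_of_dvd _ hg (mem_span_range_update_self v j g)
  · exact Ideal.subset_span ⟨j, Function.update_of_ne hj ..⟩

theorem update_pow [DecidableEq ι] (x : ι → R) (a : ι → ℕ) (i : ι) (b : ℕ) :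
    Function.update (fun j => x j ^ a j) i (x i ^ b) = fun j => x j ^ Function.update a i b j := by
  ext j
  rcases eq_or_ne j i with rfl | hj
  · simp
  · simp [hj]

variable [Fintype ι]

/-- A finite family is independent in the sense of Lech if the coefficients of all relations
between its members lie in the ideal it generates. -/
def IsLechIndependent (v : ι → R) : Prop :=
  ∀ c : ι → R, ∑ i, c i * v i = 0 → ∀ i, c i ∈ Ideal.span (Set.range v)

theorem sum_mul_update [DecidableEq ι] (c v : ι → R) (i : ι) (g : R) :
    ∑ j, c j * Function.update v i g j = c i * g + ∑ j ∈ Finset.univ.erase i, c j * v j := by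
  rw [← Finset.add_sum_erase _ _ (Finset.mem_univ i), Function.update_self]
  congr 1
  exact Finset.sum_congr rfl fun j hj => by rw [Function.update_of_ne (Finset.ne_of_mem_erase hj)]

/-- Multiplying a relation of the new family by `h` gives a relation of `v`, whence `c i = ∑ d j * v
j`. Substituting this into the original relation gives another relation of `v`, with coefficients `d
j * g + c j` for `j ≠ i`; since `g` lies in the new ideal, so does `c j`. -/
theorem IsLechIndependent.update [DecidableEq ι] {v : ι → R} (hv : IsLechIndependent v) {i : ι}
    {g h : R} (hi : v i = g * h) : IsLechIndependent (Function.update v i g) := by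
  have hle := span_range_le_span_range_update (v := v) (i := i) (g := g) ⟨h, hi⟩
  intro c hc
  rw [sum_mul_update] at hc
  have h1 : ∑ j, Function.update (fun j => h * c j) i (c i) j * v j = 0 := by
    rw [← Finset.add_sum_erase _ _ (Finset.mem_univ i), Function.update_self, hi]
    have : ∑ j ∈ Finset.univ.erase i, Function.update (fun j => h * c j) i (c i) j * v j =
        h * ∑ j ∈ Finset.univ.erase i, c j * v j := by
      rw [Finset.mul_sum]
      exact Finset.sum_congr rfl fun j hj => by
        rw [Function.update_of_ne (Finset.ne_of_mem_erase hj), mul_assoc]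
    rw [this]
    linear_combination h * hc
  have h2 := hv _ h1 i
  rw [Function.update_self] at h2
  obtain ⟨d, hd⟩ := (Ideal.mem_span_range_iff_exists_fun).mp h2
  have h3 : ∑ j, Function.update (fun j => d j * g + c j) i (d i * g) j * v j = 0 := by
    rw [← Finset.add_sum_erase _ _ (Finset.mem_univ i), Function.update_self]
    have : ∑ j ∈ Finset.univ.erase i, Function.update (fun j => d j * g + c j) i (d i * g) j * v j
        = (∑ j ∈ Finset.univ.erase i, d j * v j) * g
          + ∑ j ∈ Finset.univ.erase i, c j * v j := by
      rw [Finset.sum_mul, ← Finset.sum_add_distrib]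
      exact Finset.sum_congr rfl fun j hj => by
        rw [Function.update_of_ne (Finset.ne_of_mem_erase hj)]; ring
    rw [this]
    rw [← Finset.add_sum_erase _ _ (Finset.mem_univ i)] at hd
    linear_combination hc + g * hd
  intro j
  rcases eq_or_ne j i with rfl | hj
  · exact hle h2
  · have h4 := hle (hv _ h3 j)
    rw [Function.update_of_ne hj] at h4
    exact (Ideal.add_mem_iff_right _
      (Ideal.mul_mem_left _ _ (mem_span_range_update_self v i g))).mp h4

/-- The colon ideal of `(v)` by `g` is `(v)` with `v i` replaced by `h`. If `r * g = ∑ c j * v j`,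
independence of the family updated by `g` controls `r - c i * h`; the condition `h ∣ g` places the
result in the ideal updated by `h`. -/
theorem IsLechIndependent.length_quotient [DecidableEq ι] {v : ι → R} (hv : IsLechIndependent v)
    {i : ι} {g h : R} (hi : v i = g * h) (hgh : h ∣ g) :
    Module.length R (R ⧸ Ideal.span (Set.range v)) =
      Module.length R (R ⧸ Ideal.span (Set.range (Function.update v i g))) +
      Module.length R (R ⧸ Ideal.span (Set.range (Function.update v i h))) := by
  refine Ideal.length_quotient_eq_add g (span_range_le_span_range_update ⟨h, hi⟩)
    (mem_span_range_update_self v i g) (span_range_update_le_sup v i g) fun r => ⟨fun hr => ?_, ?_⟩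
  · obtain ⟨c, hc⟩ := Ideal.mem_span_range_iff_exists_fun.mp hr
    have h1 : ∑ j, Function.update (-c) i (r - c i * h) j * Function.update v i g j = 0 := by
      rw [sum_mul_update, Function.update_self]
      have : ∑ j ∈ Finset.univ.erase i, Function.update (-c) i (r - c i * h) j * v j =
          - ∑ j ∈ Finset.univ.erase i, c j * v j := by
        rw [← Finset.sum_neg_distrib]
        exact Finset.sum_congr rfl fun j hj => by
          rw [Function.update_of_ne (Finset.ne_of_mem_erase hj), Pi.neg_apply, neg_mul]
      rw [this]
      rw [← Finset.add_sum_erase _ _ (Finset.mem_univ i), hi] at hc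
      linear_combination -hc
    have h2 := hv.update hi _ h1 i
    rw [Function.update_self] at h2
    have hle : Ideal.span (Set.range (Function.update v i g)) ≤
        Ideal.span (Set.range (Function.update v i h)) :=
      (span_range_update_le_sup v i g).trans (sup_le
        (span_range_le_span_range_update ⟨g, by rw [hi, mul_comm]⟩)
        ((Ideal.span_singleton_le_iff_mem _).mpr
          (Ideal.mem_of_dvd _ hgh (mem_span_range_update_self v i h))))
    have h3 := Ideal.add_mem _ (hle h2) (Ideal.mul_mem_left _ (c i)
      (mem_span_range_update_self v i h))
    rwa [sub_add_cancel] at h3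
  · intro hr
    obtain ⟨c, rfl⟩ := Ideal.mem_span_range_iff_exists_fun.mp hr
    rw [sum_mul_update, add_mul, mul_assoc, mul_comm h g, ← hi]
    refine Ideal.add_mem _ (Ideal.mul_mem_left _ _ (Ideal.subset_span ⟨i, rfl⟩))
      (Ideal.mul_mem_right _ _ (Ideal.sum_mem _ fun j _ => Ideal.mul_mem_left _ _
        (Ideal.subset_span ⟨j, rfl⟩)))

theorem length_quotient_span_range_le [DecidableEq ι] {v : ι → R}
    {i : ι} {g h : R} (hi : v i = g * h) :
    Module.length R (R ⧸ Ideal.span (Set.range v)) ≤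
      Module.length R (R ⧸ Ideal.span (Set.range (Function.update v i g))) +
      Module.length R (R ⧸ Ideal.span (Set.range (Function.update v i h))) := by
  refine Ideal.length_quotient_le_add g (span_range_le_span_range_update ⟨h, hi⟩)
    (mem_span_range_update_self v i g) (span_range_update_le_sup v i g) fun r hr => ?_
  obtain ⟨c, rfl⟩ := Ideal.mem_span_range_iff_exists_fun.mp hr
  rw [sum_mul_update, add_mul, mul_assoc, mul_comm h g, ← hi]
  exact Ideal.add_mem _ (Ideal.mul_mem_left _ _ (Ideal.subset_span ⟨i, rfl⟩))
    (Ideal.mul_mem_right _ _ (Ideal.sum_mem _ fun j _ => Ideal.mul_mem_left _ _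
      (Ideal.subset_span ⟨j, rfl⟩)))

/-- Induction on exponent vectors with positive entries, splitting an entry `k + 2` into
`k + 1` and `1`. -/
theorem exponent_induction [DecidableEq ι] {P : (ι → ℕ) → Prop} (one : P fun _ => 1)
    (split : ∀ (a : ι → ℕ) (i : ι) (k : ℕ), a i = k + 2 → P (Function.update a i (k + 1)) →
      P (Function.update a i 1) → P a) (a : ι → ℕ) (ha : ∀ i, a i ≠ 0) : P a := by
  induction hn : ∑ i, a i using Nat.strong_induction_on generalizing a with
  | _ n ih =>
    by_cases h : ∀ i, a i = 1
    · rwa [show a = fun _ => 1 from funext h]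
    · push Not at h
      obtain ⟨i, hi⟩ := h
      obtain ⟨k, hk⟩ : ∃ k, a i = k + 2 := ⟨a i - 2, by have := ha i; omega⟩
      have key : ∀ b, b ≠ 0 → b < a i → P (Function.update a i b) := fun b hb hlt => by
        refine ih _ ?_ (Function.update a i b) (fun j => ?_) rfl
        · rw [← hn]
          refine Finset.sum_lt_sum (fun j _ => ?_) ⟨i, Finset.mem_univ i, ?_⟩
          · rcases eq_or_ne j i with rfl | hj
            · simpa using hlt.le
            · simp [hj]
          · simpa using hlt
        · rcases eq_or_ne j i with rfl | hj
          · simpa using hb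
          · simpa [hj] using ha j
      exact split a i k hk (key _ (by omega) (by omega)) (key _ (by omega) (by omega))

theorem prod_update_add [DecidableEq ι] (a : ι → ℕ) (i : ι) (k : ℕ) (h : a i = k + 2) :
    ∏ j, a j = ∏ j, Function.update a i (k + 1) j + ∏ j, Function.update a i 1 j := by
  rw [Finset.prod_update_of_mem (Finset.mem_univ i), Finset.prod_update_of_mem (Finset.mem_univ i),
    ← Finset.mul_prod_erase _ _ (Finset.mem_univ i), h, Finset.sdiff_singleton_eq_erase]
  ring

/-- The upper bound, valid for arbitrary families, to be played against Lech's lower bound. -/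
theorem length_quotient_span_pow_le (y : ι → R) (a : ι → ℕ) (ha : ∀ i, a i ≠ 0) :
    Module.length R (R ⧸ Ideal.span (Set.range fun i => y i ^ a i)) ≤
      (∏ i, a i : ℕ) * Module.length R (R ⧸ Ideal.span (Set.range y)) := by
  classical
  refine exponent_induction (P := fun a =>
    Module.length R (R ⧸ Ideal.span (Set.range fun i => y i ^ a i)) ≤
      (∏ i, a i : ℕ) * Module.length R (R ⧸ Ideal.span (Set.range y))) ?_ ?_ a ha
  · beta_reduce
    rw [show (fun i => y i ^ 1) = y from funext fun _ => pow_one _]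
    simp
  · intro a i k hk h1 h2
    have := length_quotient_span_range_le (v := fun j => y j ^ a j) (i := i) (g := y i ^ (k + 1))
      (h := y i ^ 1) (by simp only [hk, ← pow_add])
    rw [update_pow, update_pow] at this
    refine this.trans ((add_le_add h1 h2).trans ?_)
    rw [prod_update_add a i k hk, Nat.cast_add, add_mul]

/-- Lech's lemma: if `x_i ^ a_i` is an independent family, then `R / (x_i ^ a_i)` has length at
least `∏ a_i`. -/
theorem IsLechIndependent.prod_le_length {x : ι → R} (hx : Ideal.span (Set.range x) ≠ ⊤)
    (a : ι → ℕ) (ha : ∀ i, a i ≠ 0) (hv : IsLechIndependent fun i => x i ^ a i) :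
    ((∏ i, a i : ℕ) : ℕ∞) ≤
      Module.length R (R ⧸ Ideal.span (Set.range fun i => x i ^ a i)) := by
  classical
  refine exponent_induction (P := fun a => (IsLechIndependent fun i => x i ^ a i) →
    ((∏ i, a i : ℕ) : ℕ∞) ≤
      Module.length R (R ⧸ Ideal.span (Set.range fun i => x i ^ a i))) ?_ ?_ a ha hv
  · intro _
    beta_reduce
    rw [show (fun i => x i ^ 1) = x from funext fun _ => pow_one _]
    have : Nontrivial (R ⧸ Ideal.span (Set.range x)) := Ideal.Quotient.nontrivial_iff.mpr hx
    simpa [Order.one_le_iff_pos] using Module.length_pos (R := R)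
  · intro a i k hk h1 h2 hv
    have e1 : (x i) ^ a i = x i ^ (k + 1) * x i ^ 1 := by rw [hk, ← pow_add]
    have := hv.length_quotient (i := i) e1 (pow_dvd_pow _ (by omega))
    have i1 := hv.update (i := i) e1
    have i2 := hv.update (i := i) (e1.trans (mul_comm _ _))
    rw [update_pow] at i1 i2
    rw [update_pow, update_pow] at this
    rw [this, prod_update_add a i k hk, Nat.cast_add]
    exact add_le_add (h1 i1) (h2 i2)

end Lech

/-! ### Kunz's theorem: flat Frobenius implies regular. -/

section Kunz

open IsLocalRing

universe u

variable {R : Type*} [CommRing R]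

/-- Equational criterion for flatness of a ring homomorphism. -/
theorem RingHom.Flat.exists_of_sum_mul_eq_zero {S ι : Type*} [CommRing S] [Fintype ι]
    {f : R →+* S} (hf : f.Flat) {x : ι → R} {c : ι → S} (h : ∑ i, f (x i) * c i = 0) :
    ∃ (k : ℕ) (a : ι → Fin k → R) (y : Fin k → S),
      (∀ i, c i = ∑ j, f (a i j) * y j) ∧ ∀ j, ∑ i, x i * a i j = 0 := by
  algebraize [f]
  obtain ⟨k, a, y, hy, ha⟩ := Module.Flat.isTrivialRelation_of_sum_smul_eq_zero
    (f := x) (x := c) (by simpa only [Algebra.smul_def] using! h)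
  exact ⟨k, a, y, fun i => by rw [hy i]; simp only [Algebra.smul_def]; rfl, ha⟩

/-- If `f` is flat and is the `q`-th power map, then the `q`-th powers of a minimal generating
family are independent. -/
theorem isLechIndependent_pow_of_flat [IsLocalRing R] {ι : Type*} [Fintype ι] {x : ι → R}
    (hx : Ideal.span (Set.range x) = maximalIdeal R)
    (hmin : ∀ c : ι → R, ∑ i, x i * c i = 0 → ∀ i, c i ∈ maximalIdeal R)
    (f : R →+* R) {q : ℕ} (hf : ∀ r, f r = r ^ q) (hflat : f.Flat) :
    IsLechIndependent fun i => x i ^ q := by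
  intro c hc i
  obtain ⟨k, a, y, hy, ha⟩ := hflat.exists_of_sum_mul_eq_zero (x := x) (c := c)
    (by simpa only [hf, mul_comm] using hc)
  rw [hy]
  -- The columns of `a` are relations among minimal generators, so their entries lie in `m = (x)`,
  -- and `f` carries these into the ideal of `q`-th powers.
  refine Ideal.sum_mem _ fun j _ => Ideal.mul_mem_right _ _ ?_
  have h1 : a i j ∈ Ideal.span (Set.range x) := hx ▸ hmin _ (ha j) i
  obtain ⟨b, hb⟩ := Ideal.mem_span_range_iff_exists_fun.mp h1
  rw [← hb, map_sum]
  refine Ideal.sum_mem _ fun l _ => ?_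
  rw [map_mul, hf (x l)]
  exact Ideal.mul_mem_left _ _ (Ideal.subset_span ⟨l, rfl⟩)

/-- A relation with a unit coefficient would make one generator redundant, against the minimality of
`spanFinrank`. -/
theorem exists_minimal_generators_maximalIdeal (R : Type u) [CommRing R] [IsLocalRing R]
    [IsNoetherianRing R] : ∃ (ι : Type u) (_ : Fintype ι) (x : ι → R),
      Fintype.card ι = (maximalIdeal R).spanFinrank ∧
      Ideal.span (Set.range x) = maximalIdeal R ∧
      ∀ c : ι → R, ∑ i, x i * c i = 0 → ∀ i, c i ∈ maximalIdeal R := by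
  classical
  have hfg : Submodule.FG (maximalIdeal R) := IsNoetherian.noetherian _
  have hfin := hfg.finite_generators
  let := hfin.fintype
  have hcard : Fintype.card (maximalIdeal R).generators = (maximalIdeal R).spanFinrank := by
    rw [← Submodule.FG.generators_ncard hfg, Set.ncard_eq_toFinset_card', Set.toFinset_card]
  have hspan : Ideal.span (maximalIdeal R).generators = maximalIdeal R :=
    (maximalIdeal R).span_generators
  refine ⟨(maximalIdeal R).generators, inferInstance, Subtype.val, hcard, by simpa using hspan, ?_⟩
  intro c hc i
  by_contra hi
  have hu : IsUnit (c i) := by simpa using hi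
  obtain ⟨u, hu⟩ := hu
  have hle : (maximalIdeal R).generators ⊆
      Ideal.span ((maximalIdeal R).generators \ {i.1}) := by
    intro y hy
    have hmem : ∀ j : (maximalIdeal R).generators, j ≠ i →
        j.1 ∈ Ideal.span ((maximalIdeal R).generators \ {i.1}) := fun j hj =>
      Ideal.subset_span ⟨j.2, fun h => hj (Subtype.ext h)⟩
    by_cases hyi : (⟨y, hy⟩ : (maximalIdeal R).generators) = i
    · rw [← Finset.add_sum_erase _ _ (Finset.mem_univ i), ← hu] at hc
      have h : y = -(↑u⁻¹ * ∑ j ∈ Finset.univ.erase i, j.1 * c j) := by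
        have : y = i.1 := congrArg Subtype.val hyi
        rw [this]
        linear_combination (↑u⁻¹ : R) * hc - i.1 * u.inv_mul
      rw [h]
      exact Submodule.neg_mem _ (Ideal.mul_mem_left _ _ (Ideal.sum_mem _ fun j hj =>
        Ideal.mul_mem_right _ _ (hmem j (Finset.ne_of_mem_erase hj))))
    · exact hmem _ hyi
  have h1 : (maximalIdeal R).spanFinrank ≤ ((maximalIdeal R).generators \ {i.1}).ncard := by
    have : Ideal.span ((maximalIdeal R).generators \ {i.1}) = maximalIdeal R :=
      (le_antisymm (Ideal.span_mono Set.sdiff_subset) (Ideal.span_le.mpr hle)).trans hspan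
    conv_lhs => rw [← this]
    exact Submodule.spanFinrank_span_le_ncard_of_finite (hfin.subset Set.sdiff_subset)
  have h2 := Set.ncard_sdiff_singleton_lt_of_mem i.2 hfin
  rw [Submodule.FG.generators_ncard hfg] at h2
  omega

/-- Kunz's theorem: a Noetherian local ring with a flat `p`-th power endomorphism is regular. -/
theorem IsRegularLocalRing.of_flat_pow [IsLocalRing R] [IsNoetherianRing R] {p : ℕ} (hp : 2 ≤ p)
    (f : R →+* R) (hf : ∀ r, f r = r ^ p) (hflat : f.Flat) : IsRegularLocalRing R := by
  classical
  obtain ⟨ι, _, x, hcard, hx, hmin⟩ := exists_minimal_generators_maximalIdeal R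
  -- `s` is a system of parameters: it has `dim R` elements and `R/(s)` has finite length `C`.
  obtain ⟨s, hs, hscard⟩ := (maximalIdeal R).exists_finset_card_eq_height_of_isNoetherianRing
  have hfe : ∀ (e : ℕ) r, (f ^ e) r = r ^ p ^ e := by
    intro e
    induction e with
    | zero => simp
    | succ e ih => intro r; rw [pow_succ, RingHom.mul_def, RingHom.comp_apply, ih, hf, ← pow_mul, pow_succ']
  have hflate : ∀ e : ℕ, (f ^ e).Flat := by
    intro e
    induction e with
    | zero => exact RingHom.Flat.id R
    | succ e ih => rw [pow_succ]; exact hflat.comp ih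
  have hart : IsArtinianRing (R ⧸ Ideal.span (s : Set R)) :=
    quotient_artinian_of_mem_minimalPrimes_of_isLocalRing _ hs
  have hC : Module.length R (R ⧸ Ideal.span (s : Set R)) ≠ ⊤ := by
    rw [Module.length_eq_of_surjective (R := R ⧸ Ideal.span (s : Set R)) Ideal.Quotient.mk_surjective]
    exact Module.length_ne_top
  obtain ⟨C, hC⟩ := ENat.ne_top_iff_exists.mp hC
  -- With `q = p ^ e`, `(s^q) ⊆ (x^q)` since `f ^ e` is a ring map. Lech bounds the length of
  -- `R/(x^q)` below by `q ^ card ι`, while that of `R/(s^q)` is at most `q ^ dim R * C`.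
  have main : ∀ e : ℕ, (p ^ e) ^ Fintype.card ι ≤ (p ^ e) ^ s.card * C := by
    intro e
    have hq : p ^ e ≠ 0 := pow_ne_zero _ (by omega)
    have h1 := (isLechIndependent_pow_of_flat hx hmin (f ^ e) (hfe e) (hflate e)).prod_le_length
      (hx ▸ (maximalIdeal.isMaximal R).ne_top) (fun _ => p ^ e) fun _ => hq
    have h2 := length_quotient_span_pow_le (fun y : s => (y : R)) (fun _ => p ^ e) fun _ => hq
    have h3 : Ideal.span (Set.range fun y : s => (y : R) ^ p ^ e) ≤
        Ideal.span (Set.range fun i => x i ^ p ^ e) := by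
      rw [Ideal.span_le]
      rintro _ ⟨y, rfl⟩
      have hy : (y : R) ∈ Ideal.span (Set.range x) := hx ▸ hs.1.2 (Ideal.subset_span y.2)
      obtain ⟨b, hb⟩ := Ideal.mem_span_range_iff_exists_fun.mp hy
      simp only [SetLike.mem_coe]
      rw [← hfe, ← hb, map_sum]
      refine Ideal.sum_mem _ fun l _ => ?_
      rw [map_mul, hfe e (x l)]
      exact Ideal.mul_mem_left _ _ (Ideal.subset_span ⟨l, rfl⟩)
    have h4 := h1.trans ((Ideal.length_quotient_anti h3).trans h2)
    have h5 : Set.range (fun y : s => (y : R)) = s := by simp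
    rw [h5, ← hC] at h4
    simp only [Finset.prod_const, Finset.card_univ, Fintype.card_coe] at h4
    exact_mod_cast h4
  apply IsRegularLocalRing.of_spanFinrank_maximalIdeal_le
  rw [← hcard, ← maximalIdeal_height_eq_ringKrullDim, ← hscard]
  suffices Fintype.card ι ≤ s.card by exact_mod_cast this
  by_contra! hlt
  -- If `card ι > dim R` the estimate gives `p ^ e ≤ C` for every `e`; `e = C` already contradicts
  -- `C < p ^ C`.
  have h6 := main C
  have h7 : 0 < p ^ C := pow_pos (by omega) _
  have h8 : (p ^ C) ^ s.card * p ^ C ≤ (p ^ C) ^ s.card * C := by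
    rw [← pow_succ]
    exact (Nat.pow_le_pow_right h7 hlt).trans h6
  exact absurd (Nat.le_of_mul_le_mul_left h8 (pow_pos h7 _)) (not_le.mpr (Nat.lt_pow_self (by omega)))

end Kunz

/-! ### Regular systems of parameters; regular local rings are domains. -/

section RegularLocal

open IsLocalRing

universe u v

theorem IsLocalRing.quotient_of_le {R : Type*} [CommRing R] [IsLocalRing R] {I : Ideal R}
    (hI : I ≤ maximalIdeal R) : IsLocalRing (R ⧸ I) := by
  have : Nontrivial (R ⧸ I) := Ideal.Quotient.nontrivial_iff.mpr
    fun h => (maximalIdeal.isMaximal R).ne_top (top_le_iff.mp (h ▸ hI))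
  exact IsLocalRing.of_surjective' _ Ideal.Quotient.mk_surjective

theorem IsLocalRing.span_singleton_le_maximalIdeal {R : Type*} [CommRing R] [IsLocalRing R] {x : R}
    (hx : x ∈ maximalIdeal R) : Ideal.span {x} ≤ maximalIdeal R :=
  (Ideal.span_singleton_le_iff_mem _).mpr hx

/-- A family of `n ≤ dim R` generators of the maximal ideal of `R`. -/
structure IsRegularParameterSystem {R : Type*} [CommRing R] [IsLocalRing R] {n : ℕ}
    (v : Fin n → R) : Prop where
  span_eq : Ideal.span (Set.range v) = maximalIdeal R
  le_dim : (n : WithBot ℕ∞) ≤ ringKrullDim R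

namespace IsRegularParameterSystem

theorem mem {R : Type*} [CommRing R] [IsLocalRing R] {n : ℕ} {v : Fin n → R}
    (hv : IsRegularParameterSystem v) (i : Fin n) : v i ∈ maximalIdeal R :=
  hv.span_eq ▸ Ideal.subset_span ⟨i, rfl⟩

theorem isRegularLocalRing {R : Type*} [CommRing R] [IsLocalRing R] [IsNoetherianRing R] {n : ℕ}
    {v : Fin n → R} (hv : IsRegularParameterSystem v) : IsRegularLocalRing R := by
  refine .of_spanFinrank_maximalIdeal_le _ (le_trans ?_ hv.le_dim)
  rw [← hv.span_eq]
  have h := Submodule.spanFinrank_span_le_ncard_of_finite (R := R) (Set.finite_range v)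
  have h2 : (Set.range v).ncard ≤ n := by
    rw [← Set.image_univ]
    exact (Set.ncard_image_le Set.finite_univ).trans (by simp)
  exact_mod_cast h.trans h2

theorem ringKrullDim_le {R : Type*} [CommRing R] [IsLocalRing R] [IsNoetherianRing R] {n : ℕ}
    {v : Fin n → R} (hv : Ideal.span (Set.range v) = maximalIdeal R) :
    ringKrullDim R ≤ n := by
  refine (ringKrullDim_le_spanFinrank_maximalIdeal R).trans ?_
  rw [← hv]
  have h := Submodule.spanFinrank_span_le_ncard_of_finite (R := R) (Set.finite_range v)
  have h2 : (Set.range v).ncard ≤ n := by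
    rw [← Set.image_univ]
    exact (Set.ncard_image_le Set.finite_univ).trans (by simp)
  exact_mod_cast h.trans h2

theorem span_tail_sup {R : Type*} [CommRing R] {n : ℕ} (v : Fin (n + 1) → R) :
    Ideal.span (Set.range v) = Ideal.span {v 0} ⊔ Ideal.span (Set.range (Fin.tail v)) := by
  rw [← Ideal.span_union]
  congr 1
  ext x
  simp [Fin.exists_fin_succ, Fin.tail, eq_comm]

theorem quotient {R : Type*} [CommRing R] [IsLocalRing R] [IsNoetherianRing R] {n : ℕ}
    {v : Fin (n + 1) → R} (hv : IsRegularParameterSystem v)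
    [IsLocalRing (R ⧸ Ideal.span {v 0})] :
    IsRegularParameterSystem fun i => Ideal.Quotient.mk (Ideal.span {v 0}) (Fin.tail v i) where
  span_eq := by
    rw [← map_maximalIdeal_of_surjective _ (Ideal.Quotient.mk_surjective (I := Ideal.span {v 0})),
      ← hv.span_eq, span_tail_sup, Ideal.map_sup, Ideal.map_quotient_self, bot_sup_eq,
      Ideal.map_span, ← Set.range_comp]
    rfl
  le_dim := by
    -- Killing one element of `m` lowers the dimension by at most one.
    have h := ringKrullDim_le_ringKrullDim_quotient_add_card {v 0}
      (by simpa [ringJacobson_eq_maximalIdeal] using hv.mem 0)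
    have h2 := hv.le_dim.trans h
    rw [Finset.card_singleton, Finset.coe_singleton] at h2
    push_cast at h2
    exact ENat.WithBot.add_le_add_one_right_iff.mp h2

theorem exists_of_isRegularLocalRing (R : Type*) [CommRing R] [h : IsRegularLocalRing R] :
    ∃ (n : ℕ) (v : Fin n → R), IsRegularParameterSystem v := by
  obtain ⟨ι, _, x, hcard, hx, -⟩ := exists_minimal_generators_maximalIdeal R
  refine ⟨_, x ∘ (Fintype.equivFin ι).symm, ?_, ?_⟩
  · rw [← hx, (Fintype.equivFin ι).symm.surjective.range_comp]
  · rw [hcard, h.spanFinrank_maximalIdeal]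

/-- Exchange lemma: an element of `m ∖ m²` is the first member of a regular system of
parameters. -/
theorem exists_apply_zero_eq {R : Type*} [CommRing R] [IsLocalRing R] {n : ℕ}
    {v : Fin (n + 1) → R} (hv : IsRegularParameterSystem v) {x : R} (hx : x ∈ maximalIdeal R)
    (hx2 : x ∉ maximalIdeal R ^ 2) :
    ∃ w : Fin (n + 1) → R, IsRegularParameterSystem w ∧ w 0 = x := by
  obtain ⟨b, hb⟩ := Ideal.mem_span_range_iff_exists_fun.mp (hv.span_eq.symm ▸ hx)
  obtain ⟨i, hi⟩ : ∃ i, b i ∉ maximalIdeal R := by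
    by_contra! h
    exact hx2 (hb ▸ Ideal.sum_mem _ fun i _ => by
      rw [pow_two]; exact Ideal.mul_mem_mul (h i) (hv.mem i))
  have hu : IsUnit (b i) := by simpa using hi
  obtain ⟨u, hu⟩ := hu
  refine ⟨Fin.cons x fun j => v (i.succAbove j), ⟨?_, hv.le_dim⟩, rfl⟩
  set w : Fin (n + 1) → R := Fin.cons x fun j => v (i.succAbove j) with hw
  have hj : ∀ j, v (i.succAbove j) ∈ Ideal.span (Set.range w) := fun j =>
    Ideal.subset_span ⟨j.succ, by simp [hw]⟩
  apply le_antisymm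
  · rw [Ideal.span_le]
    rintro _ ⟨j, rfl⟩
    refine Fin.cases ?_ (fun j => ?_) j
    · simpa [hw] using hx
    · simpa [hw] using hv.mem _
  · rw [← hv.span_eq, Ideal.span_le]
    rintro _ ⟨j, rfl⟩
    rcases Fin.eq_self_or_eq_succAbove i j with rfl | ⟨j, rfl⟩
    · rw [Fin.sum_univ_succAbove _ j, ← hu] at hb
      have : v j = ↑u⁻¹ * (x - ∑ k, b (j.succAbove k) * v (j.succAbove k)) := by
        linear_combination (↑u⁻¹ : R) * hb - v j * u.inv_mul
      rw [SetLike.mem_coe, this]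
      exact Ideal.mul_mem_left _ _ (Ideal.sub_mem _ (Ideal.subset_span ⟨0, rfl⟩)
        (Ideal.sum_mem _ fun k _ => Ideal.mul_mem_left _ _ (hj k)))
    · exact hj j

/-- Prime avoidance supplies `x ∈ m` outside `m²` and all minimal primes. By exchange and induction
`R/x` is a domain, so `(x)` is prime and contains a minimal prime `P`. As `x ∉ P`, `P = xP`, and
Nakayama gives `P = 0`. -/
theorem isDomain {n : ℕ} : ∀ {R : Type u} [CommRing R] [IsLocalRing R] [IsNoetherianRing R]
    {v : Fin n → R}, IsRegularParameterSystem v → IsDomain R := by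
  induction n with
  | zero =>
    intro R _ _ _ v hv
    have h := hv.span_eq
    rw [Set.range_eq_empty, Ideal.span_empty] at h
    exact (isField_iff_maximalIdeal_eq.mpr h.symm).isDomain
  | succ n ih =>
    intro R _ _ _ v hv
    have hdim : ringKrullDim R ≠ 0 := fun h => by
      have := hv.le_dim
      rw [h] at this
      norm_cast at this
    have hdim' : (maximalIdeal R).height ≠ 0 := fun h => by
      rw [← maximalIdeal_height_eq_ringKrullDim, h] at hdim
      exact hdim rfl
    have hfin : (insert (maximalIdeal R ^ 2) (minimalPrimes R)).Finite :=
      (minimalPrimes.finite_of_isNoetherianRing R).insert _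
    have key : ¬ ∃ P ∈ insert (maximalIdeal R ^ 2) (minimalPrimes R), maximalIdeal R ≤ P := by
      rintro ⟨P, rfl | hP, hle⟩
      · have : maximalIdeal R = ⊥ := by
          refine Submodule.eq_bot_of_le_smul_of_le_jacobson_bot (maximalIdeal R) (maximalIdeal R)
            (IsNoetherian.noetherian _) ?_ (IsLocalRing.maximalIdeal_le_jacobson _)
          rwa [smul_eq_mul, ← pow_two]
        exact hdim (ringKrullDim_eq_zero_of_isField (isField_iff_maximalIdeal_eq.mpr this))
      · have hPp : P.IsPrime := hP.1.1
        have : P = maximalIdeal R := le_antisymm (le_maximalIdeal hPp.ne_top) hle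
        exact hdim' (Ideal.height_eq_zero_iff.mpr (this ▸ hP))
    -- Prime avoidance tolerates `m²` as the exceptional ideal that need not be prime.
    rw [show (∃ P ∈ insert (maximalIdeal R ^ 2) (minimalPrimes R), maximalIdeal R ≤ P) ↔
      ∃ P ∈ insert (maximalIdeal R ^ 2) (minimalPrimes R), maximalIdeal R ≤ id P from Iff.rfl,
      ← Ideal.subset_union_prime_finite hfin (f := id) (maximalIdeal R ^ 2) (maximalIdeal R ^ 2)
      (fun P hP h _ => by
        rcases hP with rfl | hP
        · exact absurd rfl h
        · exact hP.1.1)] at key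
    obtain ⟨x, hx, hx'⟩ := Set.not_subset.mp key
    simp only [Set.mem_iUnion, not_exists, id, SetLike.mem_coe] at hx'
    obtain ⟨w, hw, rfl⟩ := hv.exists_apply_zero_eq hx (hx' _ (Set.mem_insert _ _))
    have := IsLocalRing.quotient_of_le (span_singleton_le_maximalIdeal hx)
    have hdom := ih hw.quotient
    have hprime : (Ideal.span {w 0}).IsPrime := (Ideal.Quotient.isDomain_iff_prime _).mp hdom
    obtain ⟨P, hP, hle⟩ := Ideal.exists_minimalPrimes_le (I := ⊥) (J := Ideal.span {w 0}) bot_le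
    have hPp : P.IsPrime := hP.1.1
    have hxP : w 0 ∉ P := hx' P (Set.mem_insert_of_mem _ hP)
    have : P = ⊥ := by
      refine Submodule.eq_bot_of_le_smul_of_le_jacobson_bot (Ideal.span {w 0}) P
        (IsNoetherian.noetherian _) (fun y hy => ?_)
        ((span_singleton_le_maximalIdeal hx).trans (IsLocalRing.maximalIdeal_le_jacobson _))
      obtain ⟨r, rfl⟩ := Ideal.mem_span_singleton'.mp (hle hy)
      rw [mul_comm]
      exact Ideal.mul_mem_mul (Ideal.mem_span_singleton_self _)
        ((hPp.mem_or_mem hy).resolve_right hxP)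
    subst this
    exact IsDomain.of_bot_isPrime R

theorem apply_zero_ne_zero {R : Type*} [CommRing R] [IsLocalRing R] [IsNoetherianRing R] {n : ℕ}
    {v : Fin (n + 1) → R} (hv : IsRegularParameterSystem v) : v 0 ≠ 0 := by
  intro h0
  have h := hv.span_eq
  rw [span_tail_sup, h0, Ideal.span_singleton_zero, bot_sup_eq] at h
  have := hv.le_dim.trans (ringKrullDim_le h)
  norm_cast at this
  omega

end IsRegularParameterSystem

theorem IsRegularLocalRing.isDomain' (R : Type*) [CommRing R] [IsRegularLocalRing R] :
    IsDomain R := by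
  obtain ⟨n, v, hv⟩ := IsRegularParameterSystem.exists_of_isRegularLocalRing R
  exact hv.isDomain

end RegularLocal

/-! ### Regular sequences and powers of their members. -/

section WeaklyRegular

open RingTheory.Sequence
open scoped Pointwise

theorem RingTheory.Sequence.IsWeaklyRegular.quotient_of_cons {S : Type*} [CommRing S] {r : S}
    {rs : List S} (h : IsWeaklyRegular S (r :: rs)) {J : Ideal S} (hJ : J = Ideal.span {r}) :
    IsWeaklyRegular (S ⧸ J) (rs.map (Ideal.Quotient.mk J)) := by
  have h2 := ((isWeaklyRegular_cons_iff S r rs).mp h).2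
  have e : (r • ⊤ : Submodule S S) = J := by
    rw [hJ, ← Submodule.ideal_span_singleton_smul]; simp
  rw [(Submodule.quotEquivOfEq _ _ e).isWeaklyRegular_congr] at h2
  exact (isWeaklyRegular_map_algebraMap_iff (S ⧸ J) (S ⧸ J) rs).mpr h2

theorem RingTheory.Sequence.IsWeaklyRegular.cons_of_quotient {S : Type*} [CommRing S] {r : S}
    {rs : List S} (hr : IsSMulRegular S r) {J : Ideal S} (hJ : J = Ideal.span {r})
    (h : IsWeaklyRegular (S ⧸ J) (rs.map (Ideal.Quotient.mk J))) :
    IsWeaklyRegular S (r :: rs) := by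
  refine (isWeaklyRegular_cons_iff S r rs).mpr ⟨hr, ?_⟩
  have e : (r • ⊤ : Submodule S S) = J := by
    rw [hJ, ← Submodule.ideal_span_singleton_smul]; simp
  rw [(Submodule.quotEquivOfEq _ _ e).isWeaklyRegular_congr]
  exact (isWeaklyRegular_map_algebraMap_iff (S ⧸ J) (S ⧸ J) rs).mp h

theorem IsRegularParameterSystem.isWeaklyRegular {n : ℕ} : ∀ {R : Type*} [CommRing R]
    [IsLocalRing R] [IsNoetherianRing R] {v : Fin n → R}, IsRegularParameterSystem v →
      IsWeaklyRegular R (List.ofFn v) := by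
  induction n with
  | zero => intro R _ _ _ v _; simp
  | succ n ih =>
    intro R _ _ _ v hv
    have := hv.isDomain
    have := IsLocalRing.quotient_of_le (IsLocalRing.span_singleton_le_maximalIdeal (hv.mem 0))
    rw [List.ofFn_succ]
    refine .cons_of_quotient (IsSMulRegular.of_ne_zero hv.apply_zero_ne_zero) rfl ?_
    rw [List.map_ofFn]
    exact ih hv.quotient

open Function LinearMap in
/-- Weak regularity of a sequence passes to extensions. -/
theorem RingTheory.Sequence.IsWeaklyRegular.of_exact {R : Type*} [CommRing R] (rs : List R) :
    ∀ {M M' M'' : Type*} [AddCommGroup M] [Module R M] [AddCommGroup M'] [Module R M']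
      [AddCommGroup M''] [Module R M''] {f : M →ₗ[R] M'} {g : M' →ₗ[R] M''},
      Injective f → Exact f g → Surjective g → IsWeaklyRegular M rs → IsWeaklyRegular M'' rs →
      IsWeaklyRegular M' rs := by
  induction rs with
  | nil => intros; exact .nil _ _
  | cons r rs ih =>
    intro M M' M'' _ _ _ _ _ _ f g hf hfg hg h h''
    rw [isWeaklyRegular_cons_iff] at h h'' ⊢
    refine ⟨isSMulRegular_of_range_eq_ker hf hfg.linearMap_ker_eq.symm h.1 h''.1, ?_⟩
    have h0 : Exact (0 : PUnit →ₗ[R] M) f := by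
      rw [LinearMap.exact_iff, LinearMap.range_zero, LinearMap.ker_eq_bot.mpr hf]
    have h1 := QuotSMulTop.map_first_exact_on_four_term_exact_of_isSMulRegular_last h0 hfg h''.1
    have h2 : Injective (QuotSMulTop.map r f) := by
      rw [← LinearMap.ker_eq_bot, h1.linearMap_ker_eq]
      simp
    exact ih h2 (QuotSMulTop.map_exact r hfg hg) (QuotSMulTop.map_surjective r hg) h.2 h''.2

-- Induction along the extension `0 → M/r^k → M/r^(k+1) → M/r → 0`, whose first map is
-- multiplication by `r`.
open Function LinearMap in
theorem RingTheory.Sequence.IsWeaklyRegular.quotSMulTop_pow {R M : Type*} [CommRing R]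
    [AddCommGroup M] [Module R M] {r : R} (hr : IsSMulRegular M r) {rs : List R}
    (h : IsWeaklyRegular (QuotSMulTop r M) rs) (k : ℕ) :
    IsWeaklyRegular (QuotSMulTop (r ^ k) M) rs := by
  induction k with
  | zero =>
    have : Subsingleton (QuotSMulTop (r ^ 0) M) := by
      rw [Submodule.Quotient.subsingleton_iff]; simp
    exact (isWeaklyRegular_iff _ _).mpr fun i hi a b _ => Subsingleton.elim a b
  | succ k ih =>
    let f : QuotSMulTop (r ^ k) M →ₗ[R] QuotSMulTop (r ^ (k + 1)) M :=
      Submodule.mapQ _ _ (LinearMap.lsmul R M r) (by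
        rintro _ ⟨m, -, rfl⟩
        refine ⟨m, trivial, ?_⟩
        change r ^ (k + 1) • m = r • r ^ k • m
        rw [pow_succ', mul_smul])
    let g : QuotSMulTop (r ^ (k + 1)) M →ₗ[R] QuotSMulTop r M :=
      Submodule.factor (by
        rintro _ ⟨m, -, rfl⟩
        refine ⟨r ^ k • m, trivial, ?_⟩
        change r • r ^ k • m = r ^ (k + 1) • m
        rw [pow_succ', mul_smul])
    refine .of_exact rs (f := f) (g := g) ?_ ?_ (Submodule.factor_surjective _) ih h
    · rw [injective_iff_map_eq_zero]
      intro y hy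
      obtain ⟨m, rfl⟩ := Submodule.mkQ_surjective _ y
      obtain ⟨n, -, hn⟩ := (Submodule.Quotient.mk_eq_zero _).mp hy
      refine (Submodule.Quotient.mk_eq_zero _).mpr ⟨n, trivial, hr ?_⟩
      simpa [pow_succ', mul_smul] using hn
    · intro y
      obtain ⟨m, rfl⟩ := Submodule.mkQ_surjective _ y
      constructor
      · intro hy
        obtain ⟨n, -, hn⟩ := (Submodule.Quotient.mk_eq_zero _).mp hy
        exact ⟨Submodule.mkQ _ n, congrArg (Submodule.mkQ _) hn⟩
      · rintro ⟨z, hz⟩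
        obtain ⟨n, rfl⟩ := Submodule.mkQ_surjective _ z
        rw [← hz]
        exact (Submodule.Quotient.mk_eq_zero _).mpr ⟨n, trivial, rfl⟩

theorem RingTheory.Sequence.IsWeaklyRegular.map_pow {R : Type*} [CommRing R] (k : ℕ)
    (rs : List R) : ∀ {M : Type*} [AddCommGroup M] [Module R M], IsWeaklyRegular M rs →
      IsWeaklyRegular M (rs.map (· ^ k)) := by
  induction rs with
  | nil => intro M _ _ h; exact h
  | cons r rs ih =>
    intro M _ _ h
    rw [isWeaklyRegular_cons_iff] at h
    rw [List.map_cons, isWeaklyRegular_cons_iff]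
    exact ⟨h.1.pow k, ih (h.2.quotSMulTop_pow h.1 k)⟩

end WeaklyRegular

/-! ### Flatness of power maps on regular local rings. -/

section Flatness

open IsLocalRing RingTheory.Sequence

theorem IsSMulRegular.of_isWeaklyRegular_cons {S : Type*} [CommRing S] {r : S} {rs : List S}
    (h : IsWeaklyRegular S (r :: rs)) : IsSMulRegular S r :=
  ((isWeaklyRegular_cons_iff S r rs).mp h).1

/-- A local homomorphism out of a regular local ring is flat if it maps a regular system of
parameters to a regular sequence. -/
theorem RingHom.Flat.of_isRegularParameterSystem {n : ℕ} : ∀ {R S : Type*} [CommRing R]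
    [IsLocalRing R] [IsNoetherianRing R] [CommRing S] [IsLocalRing S] [IsNoetherianRing S]
    {v : Fin n → R} (_ : IsRegularParameterSystem v) (f : R →+* S) [IsLocalHom f]
    (_ : IsWeaklyRegular S (List.ofFn fun i => f (v i))), f.Flat := by
  induction n with
  | zero =>
    intro R S _ _ _ _ _ _ v hv f _ h
    have hbot := hv.span_eq
    rw [Set.range_eq_empty, Ideal.span_empty] at hbot
    let := (isField_iff_maximalIdeal_eq.mpr hbot.symm).toField
    algebraize [f]
    have : Module.Free R S := Module.Free.of_divisionRing R S
    exact Module.Flat.of_free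
  | succ n ih =>
    intro R S _ _ _ _ _ _ v hv f _ h
    rw [List.ofFn_succ] at h
    have hf0 : f (v 0) ∈ maximalIdeal S := map_nonunit f _ (hv.mem 0)
    have hmap : (Ideal.span {v 0}).map f = Ideal.span {f (v 0)} := by
      rw [Ideal.map_span, Set.image_singleton]
    have := IsLocalRing.quotient_of_le (span_singleton_le_maximalIdeal (hv.mem 0))
    have hloc := IsLocalRing.quotient_of_le (I := (Ideal.span {v 0}).map f)
      (hmap ▸ span_singleton_le_maximalIdeal hf0)
    -- The local criterion along `v 0` reduces to `R/(v 0) → S/(f (v 0))`, where one parameter fewer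
    -- remains.
    refine RingHom.Flat.of_quotientMap f (v 0) (.of_isWeaklyRegular_cons h)
      (maximalIdeal_le_jacobson _ hf0) rfl rfl Ideal.le_comap_map ?_
    have : IsLocalHom (Ideal.quotientMap ((Ideal.span {v 0}).map f) f Ideal.le_comap_map) := by
      refine ⟨fun a ha => ?_⟩
      obtain ⟨a, rfl⟩ := Ideal.Quotient.mk_surjective a
      rw [Ideal.quotientMap_mk] at ha
      have : IsLocalHom (Ideal.Quotient.mk ((Ideal.span {v 0}).map f)) :=
        IsLocalHom.of_surjective _ Ideal.Quotient.mk_surjective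
      exact ((isUnit_of_map_unit f _ (isUnit_of_map_unit _ _ ha))).map _
    refine ih hv.quotient _ ?_
    have h2 := h.quotient_of_cons hmap
    rw [List.map_ofFn] at h2
    exact h2

/-- On a regular local ring, an endomorphism which is the `k`-th power map is flat. -/
theorem IsRegularLocalRing.flat_pow {R : Type*} [CommRing R] [IsRegularLocalRing R] {k : ℕ}
    (hk : k ≠ 0) (f : R →+* R) (hf : ∀ r, f r = r ^ k) : f.Flat := by
  obtain ⟨n, v, hv⟩ := IsRegularParameterSystem.exists_of_isRegularLocalRing R
  have : IsLocalHom f := ⟨fun a ha => by rwa [hf, isUnit_pow_iff hk] at ha⟩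
  refine RingHom.Flat.of_isRegularParameterSystem hv f ?_
  have := hv.isWeaklyRegular.map_pow k
  rw [List.map_ofFn] at this
  simpa only [hf] using! this

end Flatness

/-! ### Vanishing of Tor and nonzerodivisors. -/

section Tor

open CategoryTheory CategoryTheory.Limits MonoidalCategory TensorProduct

universe u

variable {A : Type u} [CommRing A]

theorem Module.Flat.isZero_tor (M N : ModuleCat.{u} A) [Module.Flat A M] (n : ℕ) :
    IsZero (((Tor (ModuleCat.{u} A) (n + 1)).obj M).obj N) := by
  let P := projectiveResolution N
  refine IsZero.of_iso ?_ (P.isoLeftDerivedObj ((tensoringLeft (ModuleCat.{u} A)).obj M) (n + 1))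
  have h := (P.complex_exactAt_succ n)
  have h2 : ((P.complex.sc (n + 1)).map (tensorLeft M)).Exact :=
    Module.Flat.lTensor_shortComplex_exact M _ h
  exact (HomologicalComplex.exactAt_iff_isZero_homology _ _).mp h2

/-- The `d`-torsion of `M` is `Tor₁(M, A/d)`. The given complex is compared with `A → A`
(multiplication by `d`) through `g₀`, `g₁`, and back through `e₀`, `e₁`. If `d m = 0`, then `m ⊗ e₁`
is a cycle, hence a boundary, so `g₁ e₁` kills `m`; as `g₁ e₁ = g₀ e₀ ≡ 1` mod `d`, `m = 0`. -/
theorem isSMulRegular_of_lTensor_exact {d : A} (hd : d ∈ nonZeroDivisors A)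
    {M P₀ P₁ P₂ : Type*} [AddCommGroup M] [Module A M] [AddCommGroup P₀] [Module A P₀]
    [AddCommGroup P₁] [Module A P₁] [AddCommGroup P₂] [Module A P₂] [Module.Projective A P₀]
    {f₂ : P₂ →ₗ[A] P₁} {f₁ : P₁ →ₗ[A] P₀} {π : P₀ →ₗ[A] A ⧸ Ideal.span {d}}
    (h₂ : ∀ y, f₁ (f₂ y) = 0) (h₁ : Function.Exact f₁ π) (hπ : Function.Surjective π)
    (hM : Function.Exact (f₂.lTensor M) (f₁.lTensor M)) : IsSMulRegular M d := by
  refine IsSMulRegular.of_right_eq_zero_of_smul fun m hm => ?_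
  obtain ⟨e₀, he₀⟩ := hπ 1
  obtain ⟨e₁, he₁⟩ : d • e₀ ∈ Set.range f₁ := (h₁ _).mp (by
    rw [map_smul, he₀, Algebra.smul_def, mul_one]
    exact Ideal.Quotient.eq_zero_iff_mem.mpr (Ideal.mem_span_singleton_self d))
  obtain ⟨g₀, hg₀⟩ := Module.projective_lifting_property (Submodule.mkQ (Ideal.span {d})) π
    (Submodule.mkQ_surjective _)
  have hg₀' : ∀ y, Ideal.Quotient.mk (Ideal.span {d}) (g₀ y) = π y := fun y =>
    LinearMap.congr_fun hg₀ y
  let D : A →ₗ[A] Ideal.span {d} :=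
    (LinearMap.toSpanSingleton A A d).codRestrict (Ideal.span {d}) fun r =>
      Ideal.mul_mem_left _ r (Ideal.mem_span_singleton_self d)
  have hD : Function.Bijective D := by
    constructor
    · intro a b hab
      exact (mem_nonZeroDivisors_iff_right.mp hd |> fun h => by
        have := congrArg Subtype.val hab
        change a * d = b * d at this
        exact sub_eq_zero.mp (h _ (by rw [sub_mul, this, sub_self])))
    · rintro ⟨y, hy⟩
      obtain ⟨r, rfl⟩ := Ideal.mem_span_singleton'.mp hy
      exact ⟨r, rfl⟩
  let g₁ : P₁ →ₗ[A] A := (LinearEquiv.ofBijective D hD).symm.toLinearMap ∘ₗ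
    (g₀ ∘ₗ f₁).codRestrict (Ideal.span {d}) fun y => by
      rw [← Ideal.Quotient.eq_zero_iff_mem]
      exact (hg₀' _).trans ((h₁ _).mpr ⟨y, rfl⟩)
  have hg₁ : ∀ y, g₁ y * d = g₀ (f₁ y) := fun y =>
    congrArg Subtype.val ((LinearEquiv.ofBijective D hD).apply_symm_apply _)
  have hg₁' : g₁ ∘ₗ f₂ = 0 := by
    ext y
    refine mem_nonZeroDivisors_iff_right.mp hd _ ?_
    rw [LinearMap.comp_apply, hg₁, h₂, map_zero]
  obtain ⟨w, hw⟩ := (hM (m ⊗ₜ e₁)).mp (by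
    rw [LinearMap.lTensor_tmul, he₁, tmul_smul, smul_tmul', hm, zero_tmul])
  have h3 : m ⊗ₜ[A] g₁ e₁ = 0 := by
    rw [← LinearMap.lTensor_tmul, ← hw, ← LinearMap.lTensor_comp_apply, hg₁',
      LinearMap.lTensor_zero, LinearMap.zero_apply]
  have h4 : g₁ e₁ • m = 0 := by
    simpa using congrArg (TensorProduct.rid A M) h3
  have h5 : g₁ e₁ = g₀ e₀ := by
    refine sub_eq_zero.mp (mem_nonZeroDivisors_iff_right.mp hd _ ?_)
    rw [sub_mul, hg₁, he₁, map_smul, smul_eq_mul, mul_comm, sub_self]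
  have h6 : g₀ e₀ - 1 ∈ Ideal.span {d} := by
    rw [← Ideal.Quotient.eq_zero_iff_mem, map_sub, hg₀', he₀, map_one, sub_self]
  obtain ⟨c, hc⟩ := Ideal.mem_span_singleton'.mp h6
  have : m = g₁ e₁ • m - c • d • m := by
    rw [h5, smul_smul, hc, ← sub_smul, sub_sub_cancel, one_smul]
  rw [this, h4, hm, smul_zero, sub_zero]

theorem isSMulRegular_of_isZero_tor {d : A} (hd : d ∈ nonZeroDivisors A) (M : ModuleCat.{u} A)
    (h : IsZero (((Tor (ModuleCat.{u} A) 1).obj M).obj (ModuleCat.of A (A ⧸ Ideal.span {d})))) :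
    IsSMulRegular M d := by
  let N := ModuleCat.of A (A ⧸ Ideal.span {d})
  let P := projectiveResolution N
  have hex : (((tensorLeft M).mapHomologicalComplex _).obj P.complex).ExactAt 1 :=
    (HomologicalComplex.exactAt_iff_isZero_homology _ _).mpr
      (h.of_iso (P.isoLeftDerivedObj ((tensoringLeft (ModuleCat.{u} A)).obj M) 1).symm)
  have hM : Function.Exact ((P.complex.d 2 1).hom.lTensor M) ((P.complex.d 1 0).hom.lTensor M) := by
    rw [HomologicalComplex.exactAt_iff' _ 2 1 0 (by simp) (by simp)] at hex
    exact (ShortComplex.ShortExact.moduleCat_exact_iff_function_exact _).mp hex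
  let π : P.complex.X 0 ⟶ N := P.π.f 0
  have hP : Function.Exact (P.complex.d 1 0).hom π.hom :=
    (ShortComplex.ShortExact.moduleCat_exact_iff_function_exact _).mp P.exact₀
  have hdd : ∀ y, (P.complex.d 1 0).hom ((P.complex.d 2 1).hom y) = 0 := fun y => by
    have := P.complex.d_comp_d 2 1 0
    exact congrArg (fun f => f.hom y) this
  have hπ : Function.Surjective π.hom :=
    (ModuleCat.epi_iff_surjective π).mp (inferInstanceAs (Epi (P.π.f 0)))
  have hproj : Module.Projective A (P.complex.X 0) :=
    (IsProjective.iff_projective _).mpr (P.projective 0)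
  exact isSMulRegular_of_lTensor_exact hd hdd hP hπ hM

end Tor

/-! ### Consequences of complete faithful flatness. -/

section CompletelyFaithfullyFlat

open TensorProduct

universe u

variable {A B : Type u} [CommRing A] [CommRing B]

/-- `A/𝔞 ⊗ M` and `M/𝔞M` are isomorphic over `A/𝔞`. -/
noncomputable def quotTensorEquivQuotSMulOverQuot (𝔞 : Ideal A) (M : Type*) [AddCommGroup M] [Module A M] :
    ((A ⧸ 𝔞) ⊗[A] M) ≃ₗ[A ⧸ 𝔞] (M ⧸ (𝔞 • ⊤ : Submodule A M)) :=
  LinearEquiv.extendScalarsOfSurjective Ideal.Quotient.mk_surjective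
    (TensorProduct.quotTensorEquivQuotSMul M 𝔞)

theorem isCompletelyFaithfullyFlat_of_faithfullyFlat (𝔞 : Ideal A) (M : Type u) [AddCommGroup M]
    [Module A M] [Module.FaithfullyFlat A M] : IsCompletelyFaithfullyFlat 𝔞 M where
  isZero_tor i := Module.Flat.isZero_tor _ _ i
  faithfullyFlat := .of_linearEquiv _ _ (quotTensorEquivQuotSMulOverQuot 𝔞 M).symm

theorem RingHom.FaithfullyFlat.isCompletelyFaithfullyFlat {f : A →+* B} (hf : f.FaithfullyFlat)
    (𝔞 : Ideal A) : f.IsCompletelyFaithfullyFlat 𝔞 := by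
  let := f.toAlgebra
  have : Module.FaithfullyFlat A B := hf
  exact isCompletelyFaithfullyFlat_of_faithfullyFlat 𝔞 B

theorem RingHom.IsCompletelyFaithfullyFlat.faithfullyFlat_quotientMap {f : A →+* B} {𝔞 : Ideal A}
    (hf : f.IsCompletelyFaithfullyFlat 𝔞) {J : Ideal B} (hJ : J = 𝔞.map f)
    (h : 𝔞 ≤ J.comap f) : (Ideal.quotientMap J f h).FaithfullyFlat := by
  subst hJ
  let := f.toAlgebra
  have hf' : _root_.IsCompletelyFaithfullyFlat 𝔞 B := hf
  have := hf'.faithfullyFlat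
  exact (RingHom.faithfullyFlat_quotientMap_iff (S := B) 𝔞).mpr
    (.of_linearEquiv _ _ (quotTensorEquivQuotSMulOverQuot 𝔞 B))

theorem RingHom.IsCompletelyFaithfullyFlat.isSMulRegular {f : A →+* B} {d : A}
    (hd : d ∈ nonZeroDivisors A) (hf : f.IsCompletelyFaithfullyFlat (Ideal.span {d})) :
    IsSMulRegular B (f d) := by
  let := f.toAlgebra
  have hf' : _root_.IsCompletelyFaithfullyFlat (Ideal.span {d}) B := hf
  have h := isSMulRegular_of_isZero_tor hd (ModuleCat.of A B) (hf'.isZero_tor 0)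
  exact fun a b hab => h (by simpa only [Algebra.smul_def] using! hab)

end CompletelyFaithfullyFlat

/-! ### Arithmetic of `δ` on local rings. -/

section DeltaRing

open IsLocalRing

namespace DeltaStructure

variable {p : ℕ} {A : Type*} [CommRing A] (D : DeltaStructure p A)

theorem δ_add_sub_mem {J : Ideal A} {a : A} (ha : a ∈ J) (b : A) :
    D.δ (a + b) - (D.δ a + D.δ b) ∈ J := by
  rw [D.δ_add, sub_sub_cancel_left]
  exact Submodule.neg_mem _ (Ideal.sum_mem _ fun k hk => Ideal.mul_mem_right _ _
    (Ideal.mul_mem_right _ _ (Ideal.pow_mem_of_mem _ ha _ (Finset.mem_Ioo.mp hk).1)))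

variable [Fact p.Prime]

theorem δ_mul_eq_φ (a b : A) : D.δ (a * b) = D.φ a * D.δ b + b ^ p * D.δ a := by
  rw [D.δ_mul, φ_apply]; ring

/-- The identity `n = n^p + p δ(n)` cannot be divided by `p` in `A`, which may have `p`-torsion; the
additivity rule identifies `δ(n)` with an integer, where division is legitimate. -/
theorem exists_δ_natCast (n : ℕ) :
    ∃ c : ℤ, D.δ (n : A) = c ∧ (p : ℤ) * c = n - (n : ℤ) ^ p := by
  have hp : p.Prime := Fact.out
  induction n with
  | zero => exact ⟨0, by simp [D.δ_zero], by simp [hp.ne_zero]⟩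
  | succ n ih =>
    obtain ⟨c, hc, hc'⟩ := ih
    refine ⟨c - ∑ k ∈ Finset.Ioo 0 p, (n : ℤ) ^ k * 1 ^ (p - k) * ((p.choose k / p : ℕ) : ℤ),
      ?_, ?_⟩
    · rw [Nat.cast_succ, D.δ_add, hc, D.δ_one, add_zero]
      simp only [Int.cast_sub, Int.cast_sum, Int.cast_mul, Int.cast_pow, Int.cast_natCast,
        Int.cast_one]
    · push_cast
      rw [add_pow_prime_eq' hp (n : ℤ) 1]
      push_cast
      linear_combination hc'

theorem exists_δ_natCast_prime_pow (n : ℕ) :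
    ∃ c : ℤ, D.δ ((p : A) ^ (n + 1)) = (p : A) ^ n * (1 - p * c) := by
  have hp : p.Prime := Fact.out
  obtain ⟨c, hc, hc'⟩ := D.exists_δ_natCast (p ^ (n + 1))
  obtain ⟨m, hm⟩ : ∃ m, (n + 1) * p = (n + 1) + (m + 1) :=
    ⟨(n + 1) * p - (n + 1) - 1, by
      have : (n + 1) * 2 ≤ (n + 1) * p := Nat.mul_le_mul_left _ hp.two_le
      omega⟩
  refine ⟨(p : ℤ) ^ m, ?_⟩
  have h : c = (p : ℤ) ^ n * (1 - p * (p : ℤ) ^ m) := by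
    have hp0 : (p : ℤ) ≠ 0 := by exact_mod_cast hp.ne_zero
    apply mul_left_cancel₀ hp0
    rw [hc']
    push_cast
    rw [← pow_mul, hm]
    ring
  push_cast at hc
  rw [hc, h]
  push_cast
  ring

variable [IsLocalRing A]

theorem isUnit_one_sub_of_mem {x : A} (hx : x ∈ maximalIdeal A) : IsUnit (1 - x) :=
  IsLocalRing.isUnit_one_sub_self_of_mem_nonunits x hx

theorem isUnit_δ_p (hp : (p : A) ∈ maximalIdeal A) : IsUnit (D.δ (p : A)) := by
  obtain ⟨c, hc⟩ := D.exists_δ_natCast_prime_pow 0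
  rw [zero_add, pow_one, pow_zero, one_mul] at hc
  rw [hc]
  exact isUnit_one_sub_of_mem (Ideal.mul_mem_right _ _ hp)

theorem isLocalHom_φ (hp : (p : A) ∈ maximalIdeal A) : IsLocalHom D.φ := by
  refine ⟨fun a ha => ?_⟩
  by_contra h
  have ha' : a ∈ maximalIdeal A := h
  have : D.φ a ∈ maximalIdeal A := by
    rw [φ_apply]
    exact Ideal.add_mem _ (Ideal.pow_mem_of_mem _ ha' _ (Fact.out : p.Prime).pos)
      (Ideal.mul_mem_right _ _ hp)
  exact this ha

theorem δ_mul_mem (hp : (p : A) ∈ maximalIdeal A) {a b : A} (ha : a ∈ maximalIdeal A)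
    (hb : b ∈ maximalIdeal A) : D.δ (a * b) ∈ maximalIdeal A := by
  have hp0 := (Fact.out : p.Prime).pos
  rw [D.δ_mul]
  exact Ideal.add_mem _ (Ideal.add_mem _
    (Ideal.mul_mem_right _ _ (Ideal.pow_mem_of_mem _ ha _ hp0))
    (Ideal.mul_mem_right _ _ (Ideal.pow_mem_of_mem _ hb _ hp0)))
    (Ideal.mul_mem_right _ _ (Ideal.mul_mem_right _ _ hp))

/-- `δ` is additive modulo `m` as soon as one summand lies in `m`, so the induction carries `a ∈ m`
along. -/
theorem δ_mem_of_mem_sq (hp : (p : A) ∈ maximalIdeal A) {a : A} (ha : a ∈ maximalIdeal A ^ 2) :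
    D.δ a ∈ maximalIdeal A := by
  suffices a ∈ maximalIdeal A ∧ D.δ a ∈ maximalIdeal A from this.2
  rw [pow_two] at ha
  refine Submodule.mul_induction_on ha (fun a ha b hb =>
    ⟨Ideal.mul_mem_right _ _ ha, D.δ_mul_mem hp ha hb⟩) fun a b ha hb =>
    ⟨Ideal.add_mem _ ha.1 hb.1, ?_⟩
  have h := Ideal.add_mem _ (D.δ_add_sub_mem ha.1 b) (Ideal.add_mem _ ha.2 hb.2)
  rwa [sub_add_cancel] at h

theorem p_notMem_sq (D : DeltaStructure p A) (hp : (p : A) ∈ maximalIdeal A) : (p : A) ∉ maximalIdeal A ^ 2 := fun h =>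
  D.δ_mem_of_mem_sq hp h (D.isUnit_δ_p hp)

/-- If `d` and `p` lie in the maximal ideal and `p ∈ (d, φ(d))`, then `δ(d)` is a unit. -/
theorem isUnit_δ_of_p_mem (hp : (p : A) ∈ maximalIdeal A) {d : A} (hd : d ∈ maximalIdeal A)
    (h : (p : A) ∈ Ideal.span {d} ⊔ Ideal.span {D.φ d}) : IsUnit (D.δ d) := by
  by_contra hu
  have hδ : D.δ d ∈ maximalIdeal A := hu
  -- If `δ(d)` lay in `m`, then `φ(d) ∈ m²`, and writing `p = a d + b φ(d)` would put the unit
  -- `δ(p)` in `m`.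
  have hφ : D.φ d ∈ maximalIdeal A ^ 2 := by
    rw [φ_apply, pow_two (maximalIdeal A)]
    refine Ideal.add_mem _ ?_ (Ideal.mul_mem_mul hp hδ)
    obtain ⟨k, hk⟩ := Nat.exists_eq_add_of_le (Fact.out : p.Prime).two_le
    rw [hk, pow_add, pow_two]
    exact Ideal.mul_mem_right _ _ (Ideal.mul_mem_mul hd hd)
  obtain ⟨_, ha, _, hb, hab⟩ := Submodule.mem_sup.mp h
  obtain ⟨a, rfl⟩ := Ideal.mem_span_singleton'.mp ha
  obtain ⟨b, rfl⟩ := Ideal.mem_span_singleton'.mp hb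
  have hp0 := (Fact.out : p.Prime).pos
  have h1 : D.δ (a * d) ∈ maximalIdeal A := by
    rw [D.δ_mul]
    exact Ideal.add_mem _ (Ideal.add_mem _ (Ideal.mul_mem_left _ _ hδ)
      (Ideal.mul_mem_right _ _ (Ideal.pow_mem_of_mem _ hd _ hp0)))
      (Ideal.mul_mem_left _ _ hδ)
  have h2 : D.δ (b * D.φ d) ∈ maximalIdeal A := D.δ_mem_of_mem_sq hp (Ideal.mul_mem_left _ _ hφ)
  have h3 := Ideal.add_mem _ (D.δ_add_sub_mem (Ideal.mul_mem_left _ a hd) (b * D.φ d))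
    (Ideal.add_mem _ h1 h2)
  rw [sub_add_cancel, hab] at h3
  exact h3 (D.isUnit_δ_p hp)

theorem mem_span_p_of_mul_pow_eq_zero (D : DeltaStructure p A)
    (hp : (p : A) ∈ maximalIdeal A)
    (hprime : (Ideal.span {(p : A)}).IsPrime) (k : ℕ) :
    ∀ s : A, s * (p : A) ^ k = 0 → s ∈ Ideal.span {(p : A)} := by
  induction k with
  | zero => intro s hs; simpa using (by simpa using hs : s = 0) ▸ Ideal.zero_mem _
  | succ k ih =>
    intro s hs
    obtain ⟨c, hc⟩ := D.exists_δ_natCast_prime_pow k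
    have h1 := D.δ_mul_eq_φ s ((p : A) ^ (k + 1))
    obtain ⟨m, hm⟩ : ∃ m, (k + 1) * p = k + (m + 1) :=
      ⟨(k + 1) * p - k - 1, by
        have : k + 1 ≤ (k + 1) * p := Nat.le_mul_of_pos_right _ (Fact.out : p.Prime).pos
        omega⟩
    rw [hs, D.δ_zero, hc, ← pow_mul, hm] at h1
    -- Applying `δ` to `s p^(k+1) = 0` leaves only a factor `p^k` outside the bracket. By induction
    -- the bracket is in `(p)`; hence so are `φ(s)`, `s^p` and, by primality, `s`.
    have h2 := ih (D.φ s * (1 - p * c) + p ^ (m + 1) * D.δ s) (by linear_combination -h1)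
    have h3 : D.φ s * (1 - p * c) ∈ Ideal.span {(p : A)} := by
      refine (Ideal.add_mem_iff_left _ (Ideal.mul_mem_right _ _ ?_)).mp h2
      exact Ideal.pow_mem_of_mem _ (Ideal.mem_span_singleton_self _) _ (Nat.succ_pos m)
    have h4 : D.φ s ∈ Ideal.span {(p : A)} := by
      obtain ⟨u, hu⟩ := isUnit_one_sub_of_mem (Ideal.mul_mem_right (c : A) _ hp)
      rw [← hu] at h3
      have := Ideal.mul_mem_right (↑u⁻¹ : A) _ h3
      rwa [Units.mul_inv_cancel_right] at this
    rw [φ_apply] at h4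
    exact hprime.mem_of_pow_mem p ((Ideal.add_mem_iff_left _
      (Ideal.mul_mem_right _ _ (Ideal.mem_span_singleton_self _))).mp h4)

/-- In a Noetherian local `δ`-ring in which `p` generates a prime ideal, `p` is a
nonzerodivisor. -/
theorem isSMulRegular_p [IsNoetherianRing A] (D : DeltaStructure p A)
    (hp : (p : A) ∈ maximalIdeal A)
    (hprime : (Ideal.span {(p : A)}).IsPrime) : IsSMulRegular A (p : A) := by
  refine IsSMulRegular.of_right_eq_zero_of_smul fun x hx => ?_
  -- An element killed by `p` is divisible by every power of `p`, so it vanishes by Krull's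
  -- intersection theorem.
  have h : ∀ k : ℕ, ∃ y, x = y * (p : A) ^ k := by
    intro k
    induction k with
    | zero => exact ⟨x, by simp⟩
    | succ k ih =>
      obtain ⟨y, hy⟩ := ih
      have : y * (p : A) ^ (k + 1) = 0 := by
        rw [smul_eq_mul, hy] at hx
        linear_combination hx
      obtain ⟨z, hz⟩ := Ideal.mem_span_singleton'.mp
        (D.mem_span_p_of_mul_pow_eq_zero hp hprime _ y this)
      exact ⟨z, by rw [hy, ← hz]; ring⟩
  have h2 : x ∈ (⨅ i : ℕ, maximalIdeal A ^ i : Ideal A) := by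
    rw [Ideal.mem_iInf]
    intro k
    obtain ⟨y, hy⟩ := h k
    rw [hy]
    exact Ideal.mul_mem_left _ _ (Ideal.pow_mem_pow hp k)
  rwa [Ideal.iInf_pow_eq_bot_of_isLocalRing _ (maximalIdeal.isMaximal A).ne_top] at h2

end DeltaStructure

end DeltaRing

/-! ### Prisms on local rings. -/

section PrismLocal

open IsLocalRing RingTheory.Sequence

variable {p : ℕ} [Fact p.Prime] {A : Type*} [CommRing A] {D : DeltaStructure p A} {I : Ideal A}

/-- For a unit `u` in `𝔞`, the nonzero sequence `u⁻ⁿ` is killed by the map required to be injective.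
-/
theorem IsDerivedComplete.le_maximalIdeal [IsLocalRing A] {𝔞 : Ideal A}
    (h : IsDerivedComplete 𝔞 A) : 𝔞 ≤ maximalIdeal A := by
  intro f hf hu
  obtain ⟨u, rfl⟩ : IsUnit f := by simpa using hu
  have h1 := (h _ hf).1 (a₁ := fun n => ((u⁻¹ ^ n : Aˣ) : A)) (a₂ := 0) (by
    funext n
    simp [pow_succ'])
  simpa using congrFun h1 0

/-- An element killing the generator kills all of `I`, on which `A` acts faithfully. -/
theorem Module.Invertible.isSMulRegular_of_eq_span (hI : Module.Invertible A I) {x : A}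
    (hx : I = Ideal.span {x}) : IsSMulRegular A x := by
  refine IsSMulRegular.of_right_eq_zero_of_smul fun a ha => ?_
  refine FaithfulSMul.eq_of_smul_eq_smul (M := A) (α := I) fun y => Subtype.ext ?_
  obtain ⟨r, hr⟩ := Ideal.mem_span_singleton'.mp
    (by rw [← hx]; exact y.2 : (y : A) ∈ Ideal.span {x})
  rw [smul_eq_mul] at ha
  simp only [SetLike.val_smul, smul_eq_mul, ← hr]
  linear_combination r * ha

theorem Module.Invertible.exists_eq_span [IsLocalRing A] (hI : Module.Invertible A I) :
    ∃ d, I = Ideal.span {d} := by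
  have : Module.Free A I := Module.free_of_flat_of_isLocalRing
  obtain ⟨e⟩ := Module.Invertible.free_iff_linearEquiv.mp this
  refine ⟨(e.symm 1 : I), le_antisymm (fun y hy => ?_) ?_⟩
  · refine Ideal.mem_span_singleton'.mpr ⟨e ⟨y, hy⟩, ?_⟩
    have : e ⟨y, hy⟩ • e.symm 1 = ⟨y, hy⟩ := by
      rw [← map_smul, smul_eq_mul, mul_one, e.symm_apply_apply]
    exact congrArg Subtype.val this
  · exact (Ideal.span_singleton_le_iff_mem _).mpr (e.symm 1).2

theorem RingHom.FaithfullyFlat.of_flat_of_isLocalHom {R S : Type*} [CommRing R] [CommRing S]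
    [IsLocalRing R] [IsLocalRing S] (f : R →+* S) [IsLocalHom f] (hf : f.Flat) :
    f.FaithfullyFlat := by
  algebraize [f]
  have : IsLocalHom (algebraMap R S) := ‹IsLocalHom f›
  exact Module.FaithfullyFlat.of_flat_of_isLocalHom (A := R) (B := S)

namespace DeltaStructure

theorem φ_natCast (D : DeltaStructure p A) : D.φ (p : A) = p := map_natCast _ _

theorem map_φ_span_p (D : DeltaStructure p A) :
    (Ideal.span {(p : A)}).map D.φ = Ideal.span {(p : A)} := by
  rw [Ideal.map_span, Set.image_singleton, φ_natCast]

theorem map_φ_sup (D : DeltaStructure p A) (I : Ideal A) :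
    (Ideal.span {(p : A)} ⊔ I).map D.φ = Ideal.span {(p : A)} ⊔ I.frobeniusPower p := by
  refine le_antisymm (Ideal.map_le_iff_le_comap.mpr (D.sup_le_comap_φ I)) ?_
  rw [Ideal.map_sup, map_φ_span_p]
  refine sup_le le_sup_left (Ideal.span_le.mpr ?_)
  rintro _ ⟨f, hf, rfl⟩
  have h1 : D.φ f ∈ Ideal.span {(p : A)} ⊔ I.map D.φ :=
    Ideal.mem_sup_right (Ideal.mem_map_of_mem _ hf)
  rw [φ_apply] at h1
  exact (Ideal.add_mem_iff_left _ (Ideal.mem_sup_left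
    (Ideal.mul_mem_right _ _ (Ideal.mem_span_singleton_self _)))).mp h1

theorem mk_φ (D : DeltaStructure p A) (a : A) :
    Ideal.Quotient.mk (Ideal.span {(p : A)}) (D.φ a) =
      Ideal.Quotient.mk (Ideal.span {(p : A)}) a ^ p := by
  rw [φ_apply, map_add, map_pow, Ideal.Quotient.eq_zero_iff_mem.mpr
    (Ideal.mul_mem_right _ _ (Ideal.mem_span_singleton_self _)), add_zero]

theorem quotientMap_φ_eq_frobeniusModP (D : DeltaStructure p A)
    (h : Ideal.span {(p : A)} ≤ (Ideal.span {(p : A)}).comap D.φ) :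
    Ideal.quotientMap (Ideal.span {(p : A)}) D.φ h = frobeniusModP p A := by
  refine Ideal.Quotient.ringHom_ext (RingHom.ext fun a => ?_)
  exact D.mk_φ a

theorem span_p_le_comap_φ (D : DeltaStructure p A) :
    Ideal.span {(p : A)} ≤ (Ideal.span {(p : A)}).comap D.φ :=
  Ideal.map_le_iff_le_comap.mp D.map_φ_span_p.le

theorem faithfullyFlat_frobeniusModP (D : DeltaStructure p A) (h : D.φ.FaithfullyFlat) :
    (frobeniusModP p A).FaithfullyFlat := by
  rw [← D.quotientMap_φ_eq_frobeniusModP D.span_p_le_comap_φ]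
  exact h.quotientMap D.map_φ_span_p.symm _

variable [IsLocalRing A]

theorem φ_faithfullyFlat_of_flat (D : DeltaStructure p A) (hp : (p : A) ∈ maximalIdeal A)
    (h : D.φ.Flat) : D.φ.FaithfullyFlat := by
  have := D.isLocalHom_φ hp
  exact .of_flat_of_isLocalHom _ h

variable [IsNoetherianRing A]

theorem φ_flat_of_frobeniusModP_flat (D : DeltaStructure p A) (hp : (p : A) ∈ maximalIdeal A)
    (hreg : IsSMulRegular A (p : A)) (h : (frobeniusModP p A).Flat) : D.φ.Flat := by
  refine RingHom.Flat.of_quotientMap D.φ (p : A) (by rwa [φ_natCast])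
    (by rw [φ_natCast]; exact maximalIdeal_le_jacobson _ hp) rfl D.map_φ_span_p.symm
    D.span_p_le_comap_φ ?_
  rwa [D.quotientMap_φ_eq_frobeniusModP]

/-- If `p, ξ` is a regular sequence then `φ(ξ)` is a nonzerodivisor. -/
theorem isSMulRegular_φ (D : DeltaStructure p A) (hp : (p : A) ∈ maximalIdeal A) {ξ : A}
    (hξ : ξ ∈ maximalIdeal A) (h : IsWeaklyRegular A [(p : A), ξ]) :
    IsSMulRegular A (D.φ ξ) := by
  have := D.isLocalHom_φ hp
  have h1 := h.quotient_of_cons rfl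
  rw [List.map_singleton, isWeaklyRegular_singleton_iff] at h1
  -- `φ(ξ) ≡ ξ^p` mod `p`. In a Noetherian local ring the sequence may then be permuted to start
  -- with `φ(ξ)`.
  have h2 : IsWeaklyRegular A [(p : A), D.φ ξ] := by
    refine .cons_of_quotient (.of_isWeaklyRegular_cons h) rfl ?_
    rw [List.map_singleton, isWeaklyRegular_singleton_iff, D.mk_φ]
    exact h1.pow p
  refine .of_isWeaklyRegular_cons (IsLocalRing.isWeaklyRegular_of_perm_of_subset_maximalIdeal h2
    (List.Perm.swap _ _ _) ?_)
  simpa using ⟨hp, hξ⟩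

end DeltaStructure

namespace IsPrism

variable [IsLocalRing A]

theorem sup_le (hI : IsPrism D I) : Ideal.span {(p : A)} ⊔ I ≤ maximalIdeal A :=
  hI.derivedComplete.le_maximalIdeal

theorem p_mem_maximalIdeal (hI : IsPrism D I) : (p : A) ∈ maximalIdeal A :=
  hI.sup_le (Ideal.mem_sup_left (Ideal.mem_span_singleton_self _))

theorem exists_generator (hI : IsPrism D I) :
    ∃ d ∈ maximalIdeal A, I = Ideal.span {d} ∧ IsSMulRegular A d ∧ IsUnit (D.δ d) := by
  obtain ⟨d, hd⟩ := hI.invertible.exists_eq_span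
  have hdm : d ∈ maximalIdeal A :=
    hI.sup_le (Ideal.mem_sup_right (hd ▸ Ideal.mem_span_singleton_self d))
  refine ⟨d, hdm, hd, hI.invertible.isSMulRegular_of_eq_span hd,
    D.isUnit_δ_of_p_mem hI.p_mem_maximalIdeal hdm ?_⟩
  have := hI.p_mem
  rwa [hd, Ideal.map_span, Set.image_singleton] at this

/-- A prism on a local ring in which `p` generates a prime ideal and is a nonzerodivisor is
transversal or crystalline. -/
theorem transversal_or_crystalline [IsNoetherianRing A] (hI : IsPrism D I)
    (hprime : (Ideal.span {(p : A)}).IsPrime) (hreg : IsSMulRegular A (p : A)) :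
    IsTransversalPrism D I ∨ IsCrystallinePrism D I := by
  obtain ⟨d, hd, hId, -, hδ⟩ := hI.exists_generator
  have hp := hI.p_mem_maximalIdeal
  by_cases hdp : d ∈ Ideal.span {(p : A)}
  · refine Or.inr ⟨hI, ?_⟩
    obtain ⟨c, rfl⟩ := Ideal.mem_span_singleton'.mp hdp
    -- For `c ∈ m`, `c p` would be a product of two elements of `m`, so `δ(c p)` could not be a
    -- unit.
    have hc : IsUnit c := by
      by_contra hc
      exact D.δ_mul_mem hp (show c ∈ maximalIdeal A from hc) hp hδ
    rw [hId, Ideal.span_singleton_mul_left_unit hc]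
  · refine Or.inl ⟨hI, d, hId,
      RingTheory.Sequence.IsRegular.of_isWeaklyRegular_of_mem_maximalIdeal _ (by simpa using ⟨hp, hd⟩) ?_⟩
    refine .cons_of_quotient hreg rfl ?_
    rw [List.map_singleton, isWeaklyRegular_singleton_iff]
    have : IsDomain (A ⧸ Ideal.span {(p : A)}) := (Ideal.Quotient.isDomain_iff_prime _).mpr hprime
    exact .of_ne_zero fun h => hdp (Ideal.Quotient.eq_zero_iff_mem.mp h)

/-- Over a regular local prism the Frobenius lift is flat. -/
theorem φ_flat_of_isRegularLocalRing [IsNoetherianRing A] (hI : IsPrism D I)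
    (hA : IsRegularLocalRing A) : D.φ.Flat := by
  have hp := hI.p_mem_maximalIdeal
  have hp0 := (Fact.out : p.Prime).ne_zero
  have hdom := IsRegularLocalRing.isDomain' A
  obtain ⟨n, v, hv⟩ := IsRegularParameterSystem.exists_of_isRegularLocalRing A
  obtain _ | n := n
  -- Without parameters `A` is a field and `p = 0 ∈ m²`, which is excluded.
  · exfalso
    have h := hv.span_eq
    rw [Set.range_eq_empty, Ideal.span_empty] at h
    rw [← h, Ideal.mem_bot] at hp
    exact D.p_notMem_sq hI.p_mem_maximalIdeal (hp ▸ Ideal.zero_mem _)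
  · obtain ⟨w, hw, hw0⟩ := hv.exists_apply_zero_eq hp (D.p_notMem_sq hp)
    rw [← hw0] at hp
    have := IsLocalRing.quotient_of_le (span_singleton_le_maximalIdeal hp)
    have hreg : IsRegularLocalRing (A ⧸ Ideal.span {w 0}) := hw.quotient.isRegularLocalRing
    have hne := hw.apply_zero_ne_zero
    rw [hw0] at hreg hp hne
    exact D.φ_flat_of_frobeniusModP_flat hp (.of_ne_zero hne)
      (IsRegularLocalRing.flat_pow hp0 _ fun _ => rfl)

/-- If the Frobenius of `A / p` is flat then the prism is a regular local prism. -/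
theorem isRegularLocalPrism_of_flat [IsNoetherianRing A] (hI : IsPrism D I)
    (h : (frobeniusModP p A).Flat) : IsRegularLocalPrism D I := by
  have hp := hI.p_mem_maximalIdeal
  have hloc := IsLocalRing.quotient_of_le (span_singleton_le_maximalIdeal hp)
  have hR : IsRegularLocalRing (A ⧸ Ideal.span {(p : A)}) :=
    .of_flat_pow (Fact.out : p.Prime).two_le _ (fun _ => rfl) h
  have hprime : (Ideal.span {(p : A)}).IsPrime :=
    (Ideal.Quotient.isDomain_iff_prime _).mp (IsRegularLocalRing.isDomain' _)
  have hreg := D.isSMulRegular_p hp hprime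
  refine ⟨hI.transversal_or_crystalline hprime hreg, ?_⟩
  obtain ⟨n, v, hv⟩ := IsRegularParameterSystem.exists_of_isRegularLocalRing
    (A ⧸ Ideal.span {(p : A)})
  choose w hw using fun i => Ideal.Quotient.mk_surjective (v i)
  -- Lifts of parameters of `A/p` together with `p` generate `m`; their number is at most `dim A`
  -- because `dim A = dim A/p + 1` for the nonzerodivisor `p`.
  refine IsRegularParameterSystem.isRegularLocalRing (v := (Fin.cons (p : A) w : Fin (n + 1) → A))
    ⟨?_, ?_⟩
  · rw [IsRegularParameterSystem.span_tail_sup, Fin.tail_cons, Fin.cons_zero]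
    have h1 : (Ideal.span (Set.range w)).map (Ideal.Quotient.mk (Ideal.span {(p : A)})) =
        (maximalIdeal A).map (Ideal.Quotient.mk (Ideal.span {(p : A)})) := by
      rw [map_maximalIdeal_of_surjective _ Ideal.Quotient.mk_surjective, ← hv.span_eq,
        Ideal.map_span, ← Set.range_comp]
      exact congrArg (fun f => Ideal.span (Set.range f)) (funext hw)
    have h2 := congrArg (Ideal.comap (Ideal.Quotient.mk (Ideal.span {(p : A)}))) h1
    rw [Ideal.comap_map_of_surjective' _ Ideal.Quotient.mk_surjective,
      Ideal.comap_map_of_surjective' _ Ideal.Quotient.mk_surjective, Ideal.mk_ker] at h2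
    rw [sup_comm, h2, sup_eq_left]
    exact span_singleton_le_maximalIdeal hp
  · rw [← ringKrullDim_quotient_span_singleton_succ_eq_ringKrullDim hreg hp]
    push_cast
    exact ENat.WithBot.add_le_add_one_right_iff.mpr hv.le_dim

end IsPrism

end PrismLocal

/-! ### From each flatness condition back to faithful flatness of `φ`. -/

section MainTheorem

open IsLocalRing RingTheory.Sequence

variable {p : ℕ} [Fact p.Prime] {A : Type*} [CommRing A] {D : DeltaStructure p A} {I : Ideal A}

theorem IsCrystallinePrism.isSMulRegular_φ_p (h : IsCrystallinePrism D I) : IsSMulRegular A (D.φ (p : A)) := by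
  rw [D.φ_natCast]
  exact h.invertible.isSMulRegular_of_eq_span h.eq_span

variable [IsLocalRing A]

theorem IsTransversalPrism.exists_generator (h : IsTransversalPrism D I) :
    ∃ ξ ∈ maximalIdeal A, I = Ideal.span {ξ} ∧ IsWeaklyRegular A [(p : A), ξ] := by
  obtain ⟨ξ, hξ, hreg⟩ := h.exists_regular
  exact ⟨ξ, h.sup_le (Ideal.mem_sup_right (hξ ▸ Ideal.mem_span_singleton_self ξ)), hξ,
    hreg.toIsWeaklyRegular⟩

variable [IsNoetherianRing A]

namespace IsPrism

/-- `φ` is faithfully flat if `A / d → A / φ(d)` is flat and `φ(d)` is a nonzerodivisor. -/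
theorem φ_faithfullyFlat_of_quotientMap (hI : IsPrism D I) {d : A} (hd : d ∈ maximalIdeal A)
    (hreg : IsSMulRegular A (D.φ d)) {I' J : Ideal A} (hI' : I' = Ideal.span {d})
    (hJ : J = I'.map D.φ) (h : I' ≤ J.comap D.φ) (hflat : (Ideal.quotientMap J D.φ h).Flat) :
    D.φ.FaithfullyFlat := by
  have hp := hI.p_mem_maximalIdeal
  have := D.isLocalHom_φ hp
  exact D.φ_faithfullyFlat_of_flat hp (.of_quotientMap D.φ d hreg
    (maximalIdeal_le_jacobson _ (map_nonunit D.φ _ hd)) hI' hJ h hflat)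

theorem φ_faithfullyFlat_of_isCompletelyFaithfullyFlat (hI : IsPrism D I)
    (h : D.φ.IsCompletelyFaithfullyFlat I) : D.φ.FaithfullyFlat := by
  obtain ⟨d, hd, hId, hreg, -⟩ := hI.exists_generator
  have hreg' : IsSMulRegular A (D.φ d) := RingHom.IsCompletelyFaithfullyFlat.isSMulRegular
    (mem_nonZeroDivisors_iff_right.mpr fun x hx =>
      hreg.right_eq_zero_of_smul (by rwa [smul_eq_mul, mul_comm])) (hId ▸ h)
  exact hI.φ_faithfullyFlat_of_quotientMap hd hreg' hId rfl Ideal.le_comap_map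
    (h.faithfullyFlat_quotientMap rfl _).flat

end IsPrism

namespace IsCrystallinePrism

theorem φ_faithfullyFlat_of_φModI (h : IsCrystallinePrism D I) (hf : (D.φModI I).Flat) :
    D.φ.FaithfullyFlat :=
  h.φ_faithfullyFlat_of_quotientMap h.p_mem_maximalIdeal h.isSMulRegular_φ_p h.eq_span rfl _ hf

theorem φ_faithfullyFlat_of_φModPI (h : IsCrystallinePrism D I) (hf : (D.φModPI I).Flat) :
    D.φ.FaithfullyFlat :=
  h.φ_faithfullyFlat_of_quotientMap h.p_mem_maximalIdeal h.isSMulRegular_φ_p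
    (by rw [h.eq_span, sup_idem]) (D.map_φ_sup I).symm _ hf

end IsCrystallinePrism

namespace IsTransversalPrism

theorem φ_faithfullyFlat_of_φModI (h : IsTransversalPrism D I) (hf : (D.φModI I).Flat) :
    D.φ.FaithfullyFlat := by
  obtain ⟨ξ, hξ, hI, hreg⟩ := h.exists_generator
  exact h.φ_faithfullyFlat_of_quotientMap hξ (D.isSMulRegular_φ h.p_mem_maximalIdeal hξ hreg)
    hI rfl _ hf

/-- The local criterion is used twice: along the image of `ξ` to reach the Frobenius of `A/p`, then
along `p` to reach `φ`. -/
theorem φ_faithfullyFlat_of_φModPI (h : IsTransversalPrism D I) (hf : (D.φModPI I).Flat) :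
    D.φ.FaithfullyFlat := by
  obtain ⟨ξ, hξ, hI, hreg⟩ := h.exists_generator
  have hp := h.p_mem_maximalIdeal
  have hloc := IsLocalRing.quotient_of_le (span_singleton_le_maximalIdeal hp)
  refine D.φ_faithfullyFlat_of_flat hp
    (D.φ_flat_of_frobeniusModP_flat hp (.of_isWeaklyRegular_cons hreg) ?_)
  set K : Ideal A := Ideal.span {(p : A)}
  have h1 := hreg.quotient_of_cons rfl
  rw [List.map_singleton, isWeaklyRegular_singleton_iff] at h1
  have hcomp : (frobeniusModP p A).comp (Ideal.Quotient.mk K) = (Ideal.Quotient.mk K).comp D.φ :=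
    RingHom.ext fun a => (D.mk_φ a).symm
  have hJ : (I.frobeniusPower p).map (Ideal.Quotient.mk K) =
      (I.map (Ideal.Quotient.mk K)).map (frobeniusModP p A) := by
    have h2 := congrArg (Ideal.map (Ideal.Quotient.mk K)) (D.map_φ_sup I)
    rw [Ideal.map_map, ← hcomp, ← Ideal.map_map, Ideal.map_sup, Ideal.map_sup,
      Ideal.map_sup, Ideal.map_quotient_self, Ideal.map_bot, bot_sup_eq, bot_sup_eq] at h2
    exact h2.symm
  have hle := Ideal.map_le_iff_le_comap.mp hJ.ge
  refine RingHom.Flat.of_quotientMap (frobeniusModP p A) (Ideal.Quotient.mk K ξ) (h1.pow p)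
    (maximalIdeal_le_jacobson _ ?_) (by rw [hI, Ideal.map_span, Set.image_singleton]) hJ hle ?_
  · refine Ideal.pow_mem_of_mem _ ?_ _ (Fact.out : p.Prime).pos
    rw [← map_maximalIdeal_of_surjective _ Ideal.Quotient.mk_surjective]
    exact Ideal.mem_map_of_mem _ hξ
  -- Frobenius of `A/p` reduced modulo the image of `I` is `φModPI`, up to the isomorphisms between
  -- iterated quotients and quotients by sums.
  · have h3 : Ideal.quotientMap _ (frobeniusModP p A) hle =
        ((DoubleQuot.quotQuotEquivQuotSup K (I.frobeniusPower p)).symm.toRingHom.comp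
          (D.φModPI I)).comp (DoubleQuot.quotQuotEquivQuotSup K I).toRingHom := by
      refine Ideal.Quotient.ringHom_ext (Ideal.Quotient.ringHom_ext (RingHom.ext fun a => ?_))
      exact congrArg (Ideal.Quotient.mk _) (D.mk_φ a).symm
    rw [h3]
    exact .comp (.of_bijective (RingEquiv.bijective _))
      (.comp hf (.of_bijective (RingEquiv.bijective _)))

end IsTransversalPrism

end MainTheorem

theorem mainTheorem7 (p : ℕ) [Fact p.Prime] (A : Type*) [CommRing A] [IsNoetherianRing A]
    [IsLocalRing A] (D : DeltaStructure p A) (I : Ideal A) (hI : IsPrism D I) :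
    List.TFAE [
      IsRegularLocalPrism D I,
      D.φ.FaithfullyFlat,
      D.φ.IsCompletelyFaithfullyFlat (Ideal.span {(p : A)}),
      D.φ.IsCompletelyFaithfullyFlat I,
      (frobeniusModP p A).FaithfullyFlat,
      (IsTransversalPrism D I ∨ IsCrystallinePrism D I) ∧ (D.φModI I).FaithfullyFlat,
      (IsTransversalPrism D I ∨ IsCrystallinePrism D I) ∧ (D.φModPI I).FaithfullyFlat] := by
  tfae_have 1 → 2 := fun h => D.φ_faithfullyFlat_of_flat hI.p_mem_maximalIdeal
    (hI.φ_flat_of_isRegularLocalRing h.isRegularLocalRing)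
  tfae_have 2 → 5 := D.faithfullyFlat_frobeniusModP
  tfae_have 5 → 1 := fun h => hI.isRegularLocalPrism_of_flat h.flat
  tfae_have 2 → 3 := fun h => h.isCompletelyFaithfullyFlat _
  tfae_have 2 → 4 := fun h => h.isCompletelyFaithfullyFlat _
  tfae_have 3 → 5 := fun h => by
    rw [← D.quotientMap_φ_eq_frobeniusModP D.span_p_le_comap_φ]
    exact h.faithfullyFlat_quotientMap D.map_φ_span_p.symm _
  tfae_have 4 → 2 := hI.φ_faithfullyFlat_of_isCompletelyFaithfullyFlat
  tfae_have 2 → 6 := fun h =>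
    ⟨(tfae_5_to_1 (tfae_2_to_5 h)).transversal_or_crystalline, h.quotientMap rfl _⟩
  tfae_have 2 → 7 := fun h =>
    ⟨(tfae_5_to_1 (tfae_2_to_5 h)).transversal_or_crystalline,
      h.quotientMap (D.map_φ_sup I).symm _⟩
  tfae_have 6 → 2 := fun ⟨h, hf⟩ => h.elim (·.φ_faithfullyFlat_of_φModI hf.flat)
    (·.φ_faithfullyFlat_of_φModI hf.flat)
  tfae_have 7 → 2 := fun ⟨h, hf⟩ => h.elim (·.φ_faithfullyFlat_of_φModPI hf.flat)
    (·.φ_faithfullyFlat_of_φModPI hf.flat)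
  tfae_finish
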